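/- Let $(\mathscr V,\otimes,\Bbbk)$ be a closed symmetric monoidal model category (the pushout-product of two cofibrations is a cofibration, which is trivial if one of the two is). For an algebra (monoid) $A$ in $\mathscr V$ let $\mathscr V_A$ be the category of right $A$-modules. An $A$-*coring* $(A,C)$ is a coalgebra $C$ in the monoidal category of $A$-bimodules, and $\mathscr V_A^C$ is the category of right $C$-comodules in $\mathscr V_A$. Assume that for every algebra $A$ a model structure on $\mathscr V_A$ is given and that, for every coring $(A,C)$, the category $\mathscr V_A^C$ carries the model structure left-induced along the forgetful functor $\mathscr V_A^C\to\mathscr V_A$: a morphism of $\mathscr V_A^C$ is a weak equivalence (cofibration) if and only if it is one in $\mathscr V_A$. For a morphism of algebras $\varphi\colon A\to B$ and an $A$-coring $C$ let $B_*(C)=B\otimes_A C\otimes_A B$, a $B$-coring whose comultiplication is induced by that of $C$ and by $A\to B\cong B\otimes_B B$, and whose counit is $B\otimes_A C\otimes_A B\to B\otimes_A B\to B$. A *morphism of corings* $(\varphi,f)\colon(A,C)\to(B,D)$ is a morphism of algebras $\varphi\colon A\to B$ together with a morphism of $B$-corings $f\colon B_*(C)\to D$. It gives the map $T_{\varphi,f}\colon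 C\otimes_A B\to B\otimes_A C\otimes_A B\xrightarrow{f}D\cong B\otimes_B D$ and the adjunction $$(T_{\varphi,f})_*\colon\mathscr V_A^C\rightleftarrows\mathscr V_B^D\colon(T_{\varphi,f})^*,$$ where $(T_{\varphi,f})_*(M)=M\otimes_A B$ with coaction $M\otimes_A B\to M\otimes_A C\otimes_A B\xrightarrow{1\otimes T_{\varphi,f}}(M\otimes_A B)\otimes_B D$. * $\varphi$ *satisfies effective homotopic descent with respect to $C$* if the adjunction $\mathscr V_A^C\rightleftarrows\mathscr V_B^{B_*(C)}$ obtained in this way from $f=\mathrm{id}$ is a Quillen equivalence. * A morphism $g\colon C\to C'$ of $A$-corings is a *copure weak equivalence* if it is a weak equivalence in $\mathscr V_A$ and, for every fibrant $M\in\mathscr V_A^{C'}$, the counit $g_*g^*M\to M$ of the change-of-corings adjunction $g_*\colon\mathscr V_A^C\rightleftarrows\mathscr V_A^{C'}\colon g^*$ is a weak equivalence; here $g_*$ keeps the underlying module and composes the coaction with $g$. * $(A,C)$ is *flat* if $-\otimes_A C\colon\mathscr V_A\to\mathscr V$ preserves coreflexive equalizers. * A left $A$-module $N$ is *strongly homotopy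 flat* if $-\otimes_A N\colon\mathscr V_A\to\mathscr V$ preserves weak equivalences and, for every finite category $\mathsf J$ and every functor $\Phi\colon\mathsf J\to\mathscr V_A$, the natural map $(\lim_{\mathsf J}\Phi)\otimes_A N\to\lim_{\mathsf J}(\Phi\otimes_A N)$ is a weak equivalence in $\mathscr V$. **Statement.** Let $(\varphi,f)\colon(A,C)\to(B,D)$ be a morphism of corings in $\mathscr V$ such that $-\otimes_A B\colon\mathscr V_A\to\mathscr V_B$ is a left Quillen functor. 1. If $\varphi$ satisfies effective homotopic descent with respect to $C$ and $f\colon B_*(C)\to D$ is a copure weak equivalence, then the adjunction $(T_{\varphi,f})_*\dashv(T_{\varphi,f})^*$ is a Quillen equivalence. 2. Conversely, suppose that the weak equivalences of $\mathscr V_B$ are created by the forgetful functor $\mathscr V_B\to\mathscr V$, that $(A,C)$ is flat, that $B$ is strongly homotopy flat as a left $A$-module, and that $B$ is fibrant in $\mathscr V_B$. If $(T_{\varphi,f})_*\dashv(T_{\varphi,f})^*$ is a Quillen equivalence, then $\varphi$ satisfies effective homotopic descent with respect to $C$ and $f\colon B_*(C)\to D$ is a copure weak equivalence. -/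

import Mathlib

open CategoryTheory HomotopicalAlgebra

universe w v u

namespace CoringMorita

/-! ## Comonads, comodules and braided 1-cells in a bicategory

In the bicategory of algebras and bimodules below, a coring over `A` is a comonoid object in the
monoidal category of endomorphisms of `A`, i.e. of `A`-bimodules. -/

section BicategoricalPart

open scoped Bicategory

variable {𝓑 : Type u} [Bicategory.{w, v} 𝓑]

section

/-- An adjunction in a bicategory from the explicit triangle identities. -/
def adjunctionOfTriangles {a b : 𝓑} {f : a ⟶ b} {g : b ⟶ a} (κ : 𝟙 a ⟶ f ≫ g) (θ : g ≫ f ⟶ 𝟙 b)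
    (hl : κ ▷ f ≫ (α_ f g f).hom ≫ f ◁ θ ≫ (ρ_ f).hom = (λ_ f).hom)
    (hr : g ◁ κ ≫ (α_ g f g).inv ≫ θ ▷ g ≫ (λ_ g).hom = (ρ_ g).hom) :
    Bicategory.Adjunction f g where
  unit := κ
  counit := θ
  left_triangle := by
    rw [Iso.eq_comp_inv, ← hl]
    simp [Bicategory.leftZigzag, bicategoricalComp]
  right_triangle := by
    rw [Iso.eq_comp_inv, ← hr]
    simp [Bicategory.rightZigzag, bicategoricalComp]

variable {a : 𝓑} (C : Comon (EndMonoidal a))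

/-- The comultiplication of a coring. -/
abbrev comulMap : (C.X : a ⟶ a) ⟶ (C.X : a ⟶ a) ≫ (C.X : a ⟶ a) :=
  Bicategory.Comonad.comul (t := C.X)

/-- The counit of a coring. -/
abbrev counitMap : (C.X : a ⟶ a) ⟶ 𝟙 a :=
  Bicategory.Comonad.counit (t := C.X)

theorem counit_comul : comulMap C ≫ counitMap C ▷ C.X = (λ_ (C.X : a ⟶ a)).inv :=
  Bicategory.Comonad.counit_comul (C.X : a ⟶ a)

theorem comul_counit : comulMap C ≫ C.X ◁ counitMap C = (ρ_ (C.X : a ⟶ a)).inv :=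
  Bicategory.Comonad.comul_counit (C.X : a ⟶ a)

theorem comul_assoc : comulMap C ≫ C.X ◁ comulMap C =
    comulMap C ≫ comulMap C ▷ C.X ≫ (α_ (C.X : a ⟶ a) C.X C.X).hom :=
  Bicategory.Comonad.comul_assoc (C.X : a ⟶ a)

end

/-- The comonad `- ⊗ C` on the category of 1-cells `o ⟶ a`. -/
def tensorComonad (o : 𝓑) {a : 𝓑} (C : Comon (EndMonoidal a)) : Comonad (o ⟶ a) :=
  Comonad.mk (Bicategory.postcomp o (C.X : a ⟶ a))
    { app := fun M => M ◁ counitMap C ≫ (ρ_ M).hom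
      naturality := by
        intro M N g
        change g ▷ C.X ≫ N ◁ counitMap C ≫ (ρ_ N).hom = (M ◁ counitMap C ≫ (ρ_ M).hom) ≫ g
        rw [← Bicategory.whisker_exchange_assoc]
        simp }
    { app := fun M => M ◁ comulMap C ≫ (α_ M C.X C.X).inv
      naturality := by
        intro M N g
        change g ▷ C.X ≫ N ◁ comulMap C ≫ (α_ N C.X C.X).inv =
          (M ◁ comulMap C ≫ (α_ M C.X C.X).inv) ≫ (g ▷ C.X) ▷ C.X
        rw [← Bicategory.whisker_exchange_assoc]
        simp }
    (by
      intro M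
      have h := congrArg (fun t => M ◁ t) (comul_assoc C)
      simp only [Bicategory.whiskerLeft_comp] at h
      change (M ◁ comulMap C ≫ (α_ M C.X C.X).inv) ≫
          (M ◁ comulMap C ≫ (α_ M C.X C.X).inv) ▷ C.X =
        (M ◁ comulMap C ≫ (α_ M C.X C.X).inv) ≫
          (M ≫ C.X) ◁ comulMap C ≫ (α_ (M ≫ C.X) C.X C.X).inv
      rw [Bicategory.comp_whiskerLeft]
      simp only [Category.assoc, Iso.inv_hom_id_assoc]
      rw [reassoc_of% h]
      simp)
    (by
      intro M
      have h := congrArg (fun t => M ◁ t) (comul_counit C)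
      simp only [Bicategory.whiskerLeft_comp] at h
      change (M ◁ comulMap C ≫ (α_ M C.X C.X).inv) ≫
        (M ≫ C.X) ◁ counitMap C ≫ (ρ_ (M ≫ C.X)).hom = 𝟙 (M ≫ C.X)
      rw [Bicategory.comp_whiskerLeft]
      simp only [Category.assoc, Iso.inv_hom_id_assoc]
      rw [reassoc_of% h]
      simp)
    (by
      intro M
      have h := congrArg (fun t => M ◁ t) (counit_comul C)
      simp only [Bicategory.whiskerLeft_comp] at h
      change (M ◁ comulMap C ≫ (α_ M C.X C.X).inv) ≫
        (M ◁ counitMap C ≫ (ρ_ M).hom) ▷ C.X = 𝟙 (M ≫ C.X)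
      simp [reassoc_of% h])

/-- The category of comodules over `C` with underlying 1-cell `M : o ⟶ a`: coalgebras for the
comonad `- ⊗ C`, i.e. 1-cells `M` with a coassociative and counital coaction `M ⟶ M ⊗ C`; the
morphisms are the 2-cells compatible with the coactions. -/
abbrev ComodCat (o : 𝓑) {a : 𝓑} (C : Comon (EndMonoidal a)) := (tensorComonad o C).Coalgebra

section
variable {o a : 𝓑} {C : Comon (EndMonoidal a)} (M : ComodCat o C)

/-- The coaction `M ⟶ M ⊗ C` of a comodule. -/
def coact : M.A ⟶ M.A ≫ C.X := M.a

theorem coact_counit : coact M ≫ M.A ◁ counitMap C ≫ (ρ_ _).hom = 𝟙 _ := M.counit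

theorem coact_coassoc : coact M ≫ M.A ◁ comulMap C =
    coact M ≫ coact M ▷ C.X ≫ (α_ M.A C.X C.X).hom := by
  have h : coact M ≫ M.A ◁ comulMap C ≫ (α_ M.A C.X C.X).inv = coact M ≫ coact M ▷ C.X := M.coassoc
  rw [← reassoc_of% h]
  simp

theorem coact_hom {M N : ComodCat o C} (g : M ⟶ N) :
    coact M ≫ g.f ▷ C.X = g.f ≫ coact N := g.h

/-- A comodule from a counital and coassociative coaction. -/
def ComodCat.mk (M : o ⟶ a) (δ : M ⟶ M ≫ C.X)
    (counit : δ ≫ M ◁ counitMap C ≫ (ρ_ _).hom = 𝟙 _)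
    (coassoc : δ ≫ M ◁ comulMap C = δ ≫ δ ▷ C.X ≫ (α_ M C.X C.X).hom) : ComodCat o C where
  A := M
  a := δ
  counit := counit
  coassoc := by
    change δ ≫ M ◁ comulMap C ≫ (α_ M C.X C.X).inv = δ ≫ δ ▷ C.X
    rw [reassoc_of% coassoc]
    simp

end

/-- A braiding of a 1-cell `X` (a bimodule) relative to the corings `C` and `D`. -/
structure Braiding {a b : 𝓑} (C : Comon (EndMonoidal a)) (D : Comon (EndMonoidal b))
    (X : a ⟶ b) where
  hom : C.X ≫ X ⟶ X ≫ D.X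
  pentagon : hom ≫ X ◁ comulMap D =
    comulMap C ▷ X ≫ (α_ C.X C.X X).hom ≫ C.X ◁ hom ≫ (α_ C.X X D.X).inv ≫
      hom ▷ D.X ≫ (α_ X D.X D.X).hom
  counit : hom ≫ X ◁ counitMap D ≫ (ρ_ X).hom = counitMap C ▷ X ≫ (λ_ X).hom

namespace Braiding
variable {a b : 𝓑} {C : Comon (EndMonoidal a)} {D : Comon (EndMonoidal b)}
    {X : a ⟶ b} (T : Braiding C D X) (o : 𝓑)

/-- The `D`-comodule `M ⊗ X` with coaction
`M ⊗ X ⟶ M ⊗ C ⊗ X ⟶ M ⊗ X ⊗ D` induced by the braiding. -/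
def functorObj (M : ComodCat o C) : ComodCat o D :=
  ComodCat.mk (M.A ≫ X)
    (coact M ▷ X ≫ (α_ M.A C.X X).hom ≫ M.A ◁ T.hom ≫ (α_ M.A X D.X).inv)
    (by
      have h1 : M.A ◁ T.hom ≫ M.A ◁ X ◁ counitMap D ≫ M.A ◁ (ρ_ X).hom =
          M.A ◁ counitMap C ▷ X ≫ M.A ◁ (λ_ X).hom := by
        simpa using congrArg (fun t => M.A ◁ t) T.counit
      have h2 : coact M ▷ X ≫ (M.A ◁ counitMap C) ▷ X ≫ (ρ_ _).hom ▷ X = 𝟙 _ := by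
        simpa using congrArg (fun t => t ▷ X) (coact_counit M)
      rw [Bicategory.comp_whiskerLeft]
      simp only [Category.assoc, Iso.inv_hom_id_assoc]
      rw [show (α_ M.A X (𝟙 b)).inv ≫ (ρ_ (M.A ≫ X)).hom = M.A ◁ (ρ_ X).hom by simp, h1]
      rw [← h2]
      simp)
    (by
      have h1 : M.A ◁ T.hom ≫ M.A ◁ X ◁ comulMap D =
          M.A ◁ comulMap C ▷ X ≫ M.A ◁ (α_ C.X C.X X).hom ≫ M.A ◁ C.X ◁ T.hom ≫
          M.A ◁ (α_ C.X X D.X).inv ≫ M.A ◁ T.hom ▷ D.X ≫ M.A ◁ (α_ X D.X D.X).hom := by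
        simpa only [Bicategory.whiskerLeft_comp] using congrArg (fun t => M.A ◁ t) T.pentagon
      have h2 : coact M ▷ X ≫ (M.A ◁ comulMap C) ▷ X =
        coact M ▷ X ≫ (coact M ▷ C.X) ▷ X ≫ (α_ M.A C.X C.X).hom ▷ X := by
        simpa only [Bicategory.comp_whiskerRight] using congrArg (fun t => t ▷ X) (coact_coassoc M)
      calc _ = coact M ▷ X ≫ (α_ M.A C.X X).hom ≫ (M.A ◁ T.hom ≫ M.A ◁ X ◁ comulMap D) ≫
                (α_ M.A X (D.X ≫ D.X)).inv := by
              simp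
        _ = (coact M ▷ X ≫ (M.A ◁ comulMap C) ▷ X) ≫ (α_ _ _ _).hom ≫ M.A ◁ (α_ C.X C.X X).hom ≫ M.A ◁ C.X ◁ T.hom ≫
          M.A ◁ (α_ C.X X D.X).inv ≫ M.A ◁ T.hom ▷ D.X ≫ M.A ◁ (α_ X D.X D.X).hom ≫ (α_ M.A X (D.X ≫ D.X)).inv := by
              rw [h1]; simp
        _ = coact M ▷ X ≫ (α_ _ _ _).hom ≫ (coact M ▷ (C.X ≫ X) ≫ (M.A ≫ C.X) ◁ T.hom) ≫
            (α_ _ _ _).hom ≫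
            M.A ◁ (α_ C.X X D.X).inv ≫ M.A ◁ T.hom ▷ D.X ≫ M.A ◁ (α_ X D.X D.X).hom ≫ (α_ M.A X (D.X ≫ D.X)).inv := by
              rw [h2]; simp
        _ = _ := by
              rw [← Bicategory.whisker_exchange]; simp)

/-- The functor `T_*` from `C`-comodules to `D`-comodules governed by a braided bimodule. -/
def functor : ComodCat o C ⥤ ComodCat o D where
  obj M := T.functorObj o M
  map {M N} g :=
    { f := g.f ▷ X
      h := by
        have h2 : coact M ▷ X ≫ g.f ▷ C.X ▷ X = g.f ▷ X ≫ coact N ▷ X := by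
          simpa only [Bicategory.comp_whiskerRight] using congrArg (fun t => t ▷ X) (coact_hom g)
        change (coact M ▷ X ≫ (α_ M.A C.X X).hom ≫ M.A ◁ T.hom ≫ (α_ M.A X D.X).inv) ≫ (g.f ▷ X) ▷ D.X =
          g.f ▷ X ≫ (coact N ▷ X ≫ (α_ N.A C.X X).hom ≫ N.A ◁ T.hom ≫ (α_ N.A X D.X).inv)
        rw [← reassoc_of% h2]
        have h3 : M.A ◁ T.hom ≫ g.f ▷ (X ≫ D.X) = g.f ▷ (C.X ≫ X) ≫ N.A ◁ T.hom :=
          Bicategory.whisker_exchange _ _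
        have h4 : g.f ▷ C.X ▷ X ≫ (α_ N.A C.X X).hom = (α_ M.A C.X X).hom ≫ g.f ▷ (C.X ≫ X) := by
          simp
        rw [reassoc_of% h4, ← reassoc_of% h3]
        simp }
  map_id M := by ext; exact Bicategory.id_whiskerRight _ _
  map_comp f g := by ext; exact Bicategory.comp_whiskerRight _ _ _

end Braiding


section CanonicalCoring

variable {a b : 𝓑} {X : a ⟶ b} {Y : b ⟶ a} (adj : Bicategory.Adjunction X Y)

section

variable (c : a ⟶ a) (κ : c ⟶ c ≫ c) (θ : c ⟶ 𝟙 a)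

/-- Comultiplication of `Y ⊗ C ⊗ X`: comultiply in `C`, then insert the coevaluation. -/
def cComul : Y ≫ c ≫ X ⟶ (Y ≫ c ≫ X) ≫ (Y ≫ c ≫ X) :=
  Y ◁ (κ ▷ X ≫ (α_ c c X).hom ≫
        c ◁ ((λ_ (c ≫ X)).inv ≫ adj.unit ▷ (c ≫ X) ≫ (α_ X Y (c ≫ X)).hom) ≫
          (α_ c X (Y ≫ c ≫ X)).inv) ≫ (α_ Y (c ≫ X) (Y ≫ c ≫ X)).inv

/-- Counit of `Y ⊗ C ⊗ X`: apply the counit of `C`, then evaluate. -/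
def cCounit : Y ≫ c ≫ X ⟶ 𝟙 b := Y ◁ (θ ▷ X ≫ (λ_ X).hom) ≫ adj.counit

theorem cComul_counit_left (h : κ ≫ θ ▷ c = (λ_ c).inv) : cComul adj c κ ≫ cCounit adj c θ ▷ (Y ≫ c ≫ X) = (λ_ _).inv := by
  dsimp only [cComul, cCounit]
  calc _ = 𝟙 _ ⊗≫ Y ◁ κ ▷ X ⊗≫ Y ◁ (c ◁ adj.unit ≫ θ ▷ (X ≫ Y)) ▷ (c ≫ X) ⊗≫
              adj.counit ▷ (Y ≫ c ≫ X) ⊗≫ 𝟙 _ := by bicategory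
    _ = 𝟙 _ ⊗≫ Y ◁ (κ ≫ θ ▷ c) ▷ X ⊗≫ (Bicategory.rightZigzag adj.unit adj.counit) ▷ (c ≫ X) ⊗≫ 𝟙 _ := by
              rw [Bicategory.whisker_exchange]; bicategory
    _ = _ := by
      rw [h, adj.right_triangle]; bicategory

theorem cComul_counit_right (h : κ ≫ c ◁ θ = (ρ_ c).inv) : cComul adj c κ ≫ (Y ≫ c ≫ X) ◁ cCounit adj c θ = (ρ_ _).inv := by
  dsimp only [cComul, cCounit]
  calc _ = 𝟙 _ ⊗≫ Y ◁ κ ▷ X ⊗≫ Y ◁ c ◁ (adj.unit ▷ c ≫ (X ≫ Y) ◁ θ) ▷ X ⊗≫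
              (Y ≫ c ≫ X) ◁ adj.counit ⊗≫ 𝟙 _ := by bicategory
    _ = 𝟙 _ ⊗≫ Y ◁ (κ ≫ c ◁ θ) ▷ X ⊗≫ Y ◁ c ◁ (Bicategory.leftZigzag adj.unit adj.counit) ⊗≫ 𝟙 _ := by
              rw [← Bicategory.whisker_exchange]; bicategory
    _ = _ := by
      rw [h, adj.left_triangle]; bicategory

theorem cComul_assoc (h : κ ≫ c ◁ κ = κ ≫ κ ▷ c ≫ (α_ c c c).hom) :
    cComul adj c κ ≫ (Y ≫ c ≫ X) ◁ cComul adj c κ =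
    cComul adj c κ ≫ cComul adj c κ ▷ (Y ≫ c ≫ X) ≫ (α_ _ _ _).hom := by
  dsimp only [cComul]
  calc _ = 𝟙 _ ⊗≫ Y ◁ κ ▷ X ⊗≫ Y ◁ c ◁ (adj.unit ▷ c ≫ (X ≫ Y) ◁ κ) ▷ X ⊗≫
              (Y ≫ c ≫ X) ◁ Y ◁ c ◁ adj.unit ▷ (c ≫ X) ⊗≫ 𝟙 _ := by bicategory
    _ = 𝟙 _ ⊗≫ Y ◁ (κ ≫ c ◁ κ) ▷ X ⊗≫ Y ◁ c ◁ (adj.unit ▷ (c ≫ 𝟙 a) ≫ (X ≫ Y) ◁ c ◁ adj.unit) ▷ (c ≫ X) ⊗≫ 𝟙 _ := by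
              rw [← Bicategory.whisker_exchange]; bicategory
    _ = 𝟙 _ ⊗≫ Y ◁ (κ ≫ c ◁ κ) ▷ X ⊗≫ Y ◁ c ◁ (𝟙 a ◁ c ◁ adj.unit ≫ adj.unit ▷ (c ≫ X ≫ Y)) ▷ (c ≫ X) ⊗≫ 𝟙 _ := by
              rw [Bicategory.whisker_exchange]
    _ = 𝟙 _ ⊗≫ Y ◁ (κ ≫ κ ▷ c) ▷ X ⊗≫ Y ◁ c ◁ c ◁ adj.unit ▷ (c ≫ X) ⊗≫
           Y ◁ c ◁ adj.unit ▷ (c ≫ X ≫ Y ≫ c ≫ X) ⊗≫ 𝟙 _ := by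
              rw [h]; bicategory
    _ = 𝟙 _ ⊗≫ Y ◁ κ ▷ X ⊗≫ Y ◁ (κ ▷ 𝟙 a ≫ (c ≫ c) ◁ adj.unit) ▷ (c ≫ X) ⊗≫
           Y ◁ c ◁ adj.unit ▷ (c ≫ X ≫ Y ≫ c ≫ X) ⊗≫ 𝟙 _ := by
              bicategory
    _ = _ := by
      rw [← Bicategory.whisker_exchange]; bicategory

theorem univ_pentagon :
    ((λ_ (c ≫ X)).inv ≫ adj.unit ▷ (c ≫ X) ≫ (α_ X Y (c ≫ X)).hom) ≫ X ◁ cComul adj c κ =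
    κ ▷ X ≫ (α_ c c X).hom ≫ c ◁ ((λ_ (c ≫ X)).inv ≫ adj.unit ▷ (c ≫ X) ≫ (α_ X Y (c ≫ X)).hom)
     ≫ (α_ c X _).inv ≫
      ((λ_ (c ≫ X)).inv ≫ adj.unit ▷ (c ≫ X) ≫ (α_ X Y (c ≫ X)).hom) ▷ (Y ≫ c ≫ X)
      ≫ (α_ X (Y ≫ c ≫ X) (Y ≫ c ≫ X)).hom := by
  dsimp only [cComul]
  calc _ = 𝟙 _ ⊗≫ (adj.unit ▷ c ≫ (X ≫ Y) ◁ κ) ▷ X ⊗≫ X ◁ Y ◁ c ◁ adj.unit ▷ (c ≫ X) ⊗≫ 𝟙 _ := by bicategory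
    _ = 𝟙 _ ⊗≫ κ ▷ X ⊗≫ (adj.unit ▷ (c ≫ 𝟙 a) ≫ (X ≫ Y) ◁ c ◁ adj.unit) ▷ (c ≫ X) ⊗≫ 𝟙 _ := by
      rw [← Bicategory.whisker_exchange]; bicategory
    _ = _ := by
      rw [← Bicategory.whisker_exchange]; bicategory

theorem univ_counit :
    ((λ_ (c ≫ X)).inv ≫ adj.unit ▷ (c ≫ X) ≫ (α_ X Y (c ≫ X)).hom) ≫ X ◁ cCounit adj c θ ≫ (ρ_ X).hom =
    θ ▷ X ≫ (λ_ X).hom := by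
  dsimp only [cCounit]
  calc _ = 𝟙 _ ⊗≫ (adj.unit ▷ c ≫ (X ≫ Y) ◁ θ) ▷ X ⊗≫ X ◁ adj.counit ⊗≫ 𝟙 _ := by bicategory
    _ = 𝟙 _ ⊗≫ θ ▷ X ⊗≫ Bicategory.leftZigzag adj.unit adj.counit ⊗≫ 𝟙 _ := by
      rw [← Bicategory.whisker_exchange]; bicategory
    _ = _ := by
      rw [adj.left_triangle]; bicategory

end

variable (o : 𝓑)

/-- If `X` is left dual to `Y`, then `- ⊗ X` is left adjoint to `- ⊗ Y`. -/
def postcompAdjunction : Bicategory.postcomp o X ⊣ Bicategory.postcomp o Y :=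
  Adjunction.mkOfUnitCounit
   { unit := { app := fun M => (ρ_ M).inv ≫ M ◁ adj.unit ≫ (α_ M X Y).inv
               naturality := by
                 intro M N g
                 change g ≫ (ρ_ N).inv ≫ N ◁ adj.unit ≫ (α_ N X Y).inv =
                   ((ρ_ M).inv ≫ M ◁ adj.unit ≫ (α_ M X Y).inv) ≫ (g ▷ X) ▷ Y
                 calc _ = (ρ_ M).inv ≫ (g ▷ 𝟙 a ≫ N ◁ adj.unit) ≫ (α_ N X Y).inv := by simp
                   _ = _ := by rw [← Bicategory.whisker_exchange]; simp }
     counit := { app := fun M => (α_ M Y X).hom ≫ M ◁ adj.counit ≫ (ρ_ M).hom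
                 naturality := by
                   intro M N g
                   change (g ▷ Y) ▷ X ≫ (α_ N Y X).hom ≫ N ◁ adj.counit ≫ (ρ_ N).hom =
                     ((α_ M Y X).hom ≫ M ◁ adj.counit ≫ (ρ_ M).hom) ≫ g
                   calc _ = (α_ M Y X).hom ≫ (g ▷ (Y ≫ X) ≫ N ◁ adj.counit) ≫ (ρ_ N).hom := by simp
                    _ = _ := by rw [← Bicategory.whisker_exchange]; simp }
     left_triangle := by
      ext (M : o ⟶ a)
      change ((ρ_ M).inv ≫ M ◁ adj.unit ≫ (α_ M X Y).inv) ▷ X ≫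
       𝟙 _ ≫ (α_ (M ≫ X) Y X).hom ≫ (M ≫ X) ◁ adj.counit ≫ (ρ_ (M ≫ X)).hom = 𝟙 (M ≫ X)
      calc _ = 𝟙 _ ⊗≫ M ◁ Bicategory.leftZigzag adj.unit adj.counit ⊗≫ 𝟙 _ := by bicategory
        _ = _ := by rw [adj.left_triangle]; bicategory
     right_triangle := by
      ext (M : o ⟶ b)
      change ((ρ_ (M ≫ Y)).inv ≫ (M ≫ Y) ◁ adj.unit ≫ (α_ (M ≫ Y) X Y).inv) ≫
       𝟙 _ ≫ ((α_ M Y X).hom ≫ M ◁ adj.counit ≫ (ρ_ M).hom) ▷ Y = 𝟙 (M ≫ Y)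
      calc _ = 𝟙 _ ⊗≫ M ◁ Bicategory.rightZigzag adj.unit adj.counit ⊗≫ 𝟙 _ := by bicategory
        _ = _ := by rw [adj.right_triangle]; bicategory }

variable (C : Comon (EndMonoidal a))

/-- The canonical coring `X_*(C) = Y ⊗ C ⊗ X` of a 1-cell `X` with right dual `Y`. -/
def canonicalCoring : Comon (EndMonoidal b) where
  X := Y ≫ C.X ≫ X
  comon :=
    { counit := cCounit adj C.X (counitMap C)
      comul := cComul adj C.X (comulMap C)
      counit_comul := cComul_counit_left adj C.X (comulMap C) (counitMap C) (counit_comul C)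
      comul_counit := cComul_counit_right adj C.X (comulMap C) (counitMap C) (comul_counit C)
      comul_assoc := cComul_assoc adj C.X (comulMap C) (comul_assoc C) }

/-- The universal braiding `C ⊗ X ⟶ X ⊗ (Y ⊗ C ⊗ X)`, given by the coevaluation. -/
def univBraiding : Braiding C (canonicalCoring adj C) X where
  hom := (λ_ (C.X ≫ X)).inv ≫ adj.unit ▷ (C.X ≫ X) ≫ (α_ X Y (C.X ≫ X)).hom
  pentagon := univ_pentagon adj C.X (comulMap C)
  counit := univ_counit adj C.X (counitMap C)

end CanonicalCoring

section ChangeOfCorings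

variable {a b : 𝓑} {C : Comon (EndMonoidal a)} {D D' : Comon (EndMonoidal b)}

/-- The 2-cell underlying a morphism of corings. -/
abbrev homMap (g : D ⟶ D') : (D.X : b ⟶ b) ⟶ D'.X := g.hom

theorem homMap_counit (g : D ⟶ D') : homMap g ≫ counitMap D' = counitMap D :=
  IsComonHom.hom_counit g.hom

theorem homMap_comul (g : D ⟶ D') :
    homMap g ≫ comulMap D' = comulMap D ≫ homMap g ▷ D.X ≫ D'.X ◁ homMap g :=
  (IsComonHom.hom_comul g.hom).trans (by
    rw [MonoidalCategory.tensorHom_def]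
    rfl)

/-- Postcomposition of a braiding with a morphism of corings. -/
def Braiding.compHom {X : a ⟶ b} (T : Braiding C D X) (g : D ⟶ D') : Braiding C D' X where
  hom := T.hom ≫ X ◁ homMap g
  pentagon := by
    have h1 : X ◁ homMap g ≫ X ◁ comulMap D' =
        X ◁ comulMap D ≫ X ◁ homMap g ▷ D.X ≫ X ◁ D'.X ◁ homMap g := by
      simpa only [Bicategory.whiskerLeft_comp] using congrArg (fun t => X ◁ t) (homMap_comul g)
    have h2 : (C.X ≫ X) ◁ homMap g ≫ T.hom ▷ D'.X = T.hom ▷ D.X ≫ (X ≫ D.X) ◁ homMap g :=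
      Bicategory.whisker_exchange _ _
    have h3 : (X ≫ D.X) ◁ homMap g ≫ (X ◁ homMap g) ▷ D'.X =
        (X ◁ homMap g) ▷ D.X ≫ (X ≫ D'.X) ◁ homMap g :=
      Bicategory.whisker_exchange _ _
    have h4 : C.X ◁ X ◁ homMap g ≫ (α_ C.X X D'.X).inv =
        (α_ C.X X D.X).inv ≫ (C.X ≫ X) ◁ homMap g := by simp
    rw [Category.assoc, h1, reassoc_of% T.pentagon, Bicategory.whiskerLeft_comp,
      Bicategory.comp_whiskerRight]
    simp only [Category.assoc]
    rw [reassoc_of% h4, reassoc_of% h2, reassoc_of% h3]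
    simp
  counit := by
    have h1 : X ◁ homMap g ≫ X ◁ counitMap D' = X ◁ counitMap D := by
      simpa only [Bicategory.whiskerLeft_comp] using congrArg (fun t => X ◁ t) (homMap_counit g)
    rw [Category.assoc, reassoc_of% h1, T.counit]

/-- The change-of-corings functor `g_*`, `(M, δ) ↦ (M, (1 ⊗ g) δ)`. -/
def changeOfCorings (o : 𝓑) (g : D ⟶ D') : ComodCat o D ⥤ ComodCat o D' where
  obj M := ComodCat.mk M.A (coact M ≫ M.A ◁ homMap g)
    (by
      have h1 : M.A ◁ homMap g ≫ M.A ◁ counitMap D' = M.A ◁ counitMap D := by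
        simpa only [Bicategory.whiskerLeft_comp] using
          congrArg (fun t => M.A ◁ t) (homMap_counit g)
      rw [Category.assoc, reassoc_of% h1, coact_counit])
    (by
      have h1 : M.A ◁ homMap g ≫ M.A ◁ comulMap D' =
          M.A ◁ comulMap D ≫ M.A ◁ homMap g ▷ D.X ≫ M.A ◁ D'.X ◁ homMap g := by
        simpa only [Bicategory.whiskerLeft_comp] using
          congrArg (fun t => M.A ◁ t) (homMap_comul g)
      have h2 : M.A ◁ homMap g ≫ coact M ▷ D'.X = coact M ▷ D.X ≫ (M.A ≫ D.X) ◁ homMap g :=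
        Bicategory.whisker_exchange _ _
      have h3 : (M.A ≫ D.X) ◁ homMap g ≫ (M.A ◁ homMap g) ▷ D'.X =
          (M.A ◁ homMap g) ▷ D.X ≫ (M.A ≫ D'.X) ◁ homMap g :=
        Bicategory.whisker_exchange _ _
      rw [Category.assoc, h1, reassoc_of% coact_coassoc, Bicategory.comp_whiskerRight]
      simp only [Category.assoc]
      rw [reassoc_of% h2, reassoc_of% h3]
      simp)
  map {M N} h :=
    { f := h.f
      h := by
        have h1 : M.A ◁ homMap g ≫ h.f ▷ D'.X = h.f ▷ D.X ≫ N.A ◁ homMap g :=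
          Bicategory.whisker_exchange _ _
        change (coact M ≫ M.A ◁ homMap g) ≫ h.f ▷ D'.X = h.f ≫ coact N ≫ N.A ◁ homMap g
        rw [Category.assoc, h1, reassoc_of% coact_hom] }

end ChangeOfCorings

section RightAdjoints

open Limits

variable {o a b : 𝓑} {C : Comon (EndMonoidal a)} {D D' : Comon (EndMonoidal b)}

theorem isLeftAdjoint_of_forget {𝓔 : Type*} [Category* 𝓔] [HasCoreflexiveEqualizers 𝓔]
    (F : 𝓔 ⥤ ComodCat o D) (h : (F ⋙ (tensorComonad o D).forget).IsLeftAdjoint) :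
    F.IsLeftAdjoint :=
  have := h
  isLeftAdjoint_triangle_lift_comonadic (tensorComonad o D).forget

theorem Braiding.isLeftAdjoint_functor [HasCoreflexiveEqualizers (ComodCat o C)] {X : a ⟶ b}
    {Y : b ⟶ a} (adj : Bicategory.Adjunction X Y) (T : Braiding C D X) :
    (T.functor o).IsLeftAdjoint :=
  isLeftAdjoint_of_forget _
    (((tensorComonad o C).adj.comp (postcompAdjunction adj o)).isLeftAdjoint)

theorem isLeftAdjoint_changeOfCorings [HasCoreflexiveEqualizers (ComodCat o D)] (g : D ⟶ D') :
    (changeOfCorings o g).IsLeftAdjoint :=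
  isLeftAdjoint_of_forget _ ((tensorComonad o D).adj.isLeftAdjoint)

end RightAdjoints

end BicategoricalPart


/-! ## Algebras, bimodules and comodules over corings in a monoidal category -/

section Algebras

open Limits MonoidalCategory MonObj

variable {V : Type u} [Category.{v} V] [MonoidalCategory V]

/-- The bimodule `_A B_B`, with `A` acting through `φ : A ⟶ B`. -/
@[simps, reducible]
def extBimod {A B : Mon V} (φ : A ⟶ B) : Bimod A B where
  X := B.X
  actLeft := φ.hom ▷ B.X ≫ μ[B.X]
  actRight := μ[B.X]
  one_actLeft := by
    rw [← comp_whiskerRight_assoc, IsMonHom.one_hom, MonObj.one_mul]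
  left_assoc := by
    rw [← comp_whiskerRight_assoc, IsMonHom.mul_hom]
    have h : A.X ◁ μ[B.X] ≫ φ.hom ▷ B.X = φ.hom ▷ (B.X ⊗ B.X) ≫ B.X ◁ μ[B.X] :=
      whisker_exchange _ _
    simp [MonoidalCategory.tensorHom_def', reassoc_of% h]
  middle_assoc := by
    have h : A.X ◁ μ[B.X] ≫ φ.hom ▷ B.X = φ.hom ▷ (B.X ⊗ B.X) ≫ B.X ◁ μ[B.X] :=
      whisker_exchange _ _
    simp [reassoc_of% h]

/-- The bimodule `_B B_A`, with `A` acting through `φ : A ⟶ B`. -/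
@[simps, reducible]
def resBimod {A B : Mon V} (φ : A ⟶ B) : Bimod B A where
  X := B.X
  actLeft := μ[B.X]
  actRight := B.X ◁ φ.hom ≫ μ[B.X]
  actRight_one := by
    rw [← MonoidalCategory.whiskerLeft_comp_assoc, IsMonHom.one_hom, MonObj.mul_one]
  right_assoc := by
    rw [← MonoidalCategory.whiskerLeft_comp_assoc, IsMonHom.mul_hom]
    have h : μ[B.X] ▷ A.X ≫ B.X ◁ φ.hom = (B.X ⊗ B.X) ◁ φ.hom ≫ μ[B.X] ▷ B.X :=
      (whisker_exchange _ _).symm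
    simp [MonoidalCategory.tensorHom_def, reassoc_of% h]
  middle_assoc := by
    have h : μ[B.X] ▷ A.X ≫ B.X ◁ φ.hom = (B.X ⊗ B.X) ◁ φ.hom ≫ μ[B.X] ▷ B.X :=
      (whisker_exchange _ _).symm
    simp [reassoc_of% h]

theorem unit_actLeft {A : Mon V} (M : Bimod (Mon.trivial V) A) : M.actLeft = (λ_ M.X).hom := by
  have h := M.one_actLeft
  have h' : 𝟙 (𝟙_ V) ▷ M.X ≫ M.actLeft = M.actLeft := by
    rw [id_whiskerRight]
    exact Category.id_comp _
  exact h'.symm.trans h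

section

variable [HasCoequalizers V] [∀ X : V, PreservesColimitsOfSize.{0, 0} (tensorLeft X)]
  [∀ X : V, PreservesColimitsOfSize.{0, 0} (tensorRight X)]

/-- The projection `M ⊗ N ⟶ M ⊗_B N`. -/
noncomputable def tπ {A B C : Mon V} (M : Bimod A B) (N : Bimod B C) : M.X ⊗ N.X ⟶ (M.tensorBimod N).X :=
  coequalizer.π (M.actRight ▷ N.X) ((α_ _ _ _).hom ≫ M.X ◁ N.actLeft)

theorem tπ_ext {A B C : Mon V} {M : Bimod A B} {N : Bimod B C} {Z : V} {f g : (M.tensorBimod N).X ⟶ Z}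
   (h : tπ M N ≫ f = tπ M N ≫ g) : f = g := coequalizer.hom_ext h

theorem tπ_condition {A B C : Mon V} (M : Bimod A B) (N : Bimod B C) :
   M.actRight ▷ N.X ≫ tπ M N = (α_ _ _ _).hom ≫ M.X ◁ N.actLeft ≫ tπ M N := by
  have h := coequalizer.condition (M.actRight ▷ N.X) ((α_ _ _ _).hom ≫ M.X ◁ N.actLeft)
  rw [Category.assoc] at h
  exact h

theorem tπ_whisker_ext {A B C : Mon V} {M : Bimod A B} {N : Bimod B C} {Y Z : V} {f g : (M.tensorBimod N).X ⊗ Y ⟶ Z}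
   (h : tπ M N ▷ Y ≫ f = tπ M N ▷ Y ≫ g) : f = g :=
  (cancel_epi ((tensorRight Y).map (coequalizer.π (M.actRight ▷ N.X) ((α_ _ _ _).hom ≫ M.X ◁ N.actLeft)))).1 h
theorem tπ_whiskerL_ext {A B C : Mon V} {M : Bimod A B} {N : Bimod B C} {Y Z : V} {f g : Y ⊗ (M.tensorBimod N).X ⟶ Z}
   (h : Y ◁ tπ M N ≫ f = Y ◁ tπ M N ≫ g) : f = g :=
  (cancel_epi ((tensorLeft Y).map (coequalizer.π (M.actRight ▷ N.X) ((α_ _ _ _).hom ≫ M.X ◁ N.actLeft)))).1 h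

theorem tπ_actLeft {A B C : Mon V} (M : Bimod A B) (N : Bimod B C) :
   A.X ◁ tπ M N ≫ (M.tensorBimod N).actLeft = (α_ _ _ _).inv ≫ M.actLeft ▷ N.X ≫ tπ M N :=
  Bimod.TensorBimod.whiskerLeft_π_actLeft M N
theorem tπ_actRight {A B C : Mon V} (M : Bimod A B) (N : Bimod B C) :
   tπ M N ▷ C.X ≫ (M.tensorBimod N).actRight = (α_ _ _ _).hom ≫ M.X ◁ N.actRight ≫ tπ M N :=
  Bimod.TensorBimod.π_tensor_id_actRight M N

theorem tπ_whiskerLeft {A B C : Mon V} (M : Bimod A B) {N N' : Bimod B C} (f : N ⟶ N') :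
   tπ M N ≫ (Bimod.whiskerLeft M f).hom = M.X ◁ f.hom ≫ tπ M N' := by
  simp only [tπ, Bimod.whiskerLeft_hom]
  exact ι_colimMap _ _
theorem tπ_whiskerRight {A B C : Mon V} {M M' : Bimod A B} (f : M ⟶ M') (N : Bimod B C)  :
   tπ M N ≫ (Bimod.whiskerRight f N).hom = f.hom ▷ N.X ≫ tπ M' N := by
  simp only [tπ, Bimod.whiskerRight_hom]
  exact ι_colimMap _ _
theorem tπ_leftUnitor {A B : Mon V} (M : Bimod A B)  :
   tπ (Bimod.regular A) M ≫ (Bimod.leftUnitorBimod M).hom.hom = M.actLeft := coequalizer.π_desc _ _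
theorem tπ_rightUnitor {A B : Mon V} (M : Bimod A B)  :
   tπ M (Bimod.regular B) ≫ (Bimod.rightUnitorBimod M).hom.hom = M.actRight := coequalizer.π_desc _ _
theorem tπ_associator {A B C D : Mon V} (M : Bimod A B) (N : Bimod B C) (P : Bimod C D) :
   tπ M N ▷ P.X ≫ tπ (M.tensorBimod N) P ≫ (Bimod.associatorBimod M N P).hom.hom =
     (α_ _ _ _).hom ≫ M.X ◁ tπ N P ≫ tπ M (N.tensorBimod P) := by
  have : tπ (M.tensorBimod N) P ≫ (Bimod.associatorBimod M N P).hom.hom = Bimod.AssociatorBimod.homAux M N P := coequalizer.π_desc _ _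
  rw [this]
  exact π_tensor_id_preserves_coequalizer_inv_desc _ _ _ _
theorem tπ_associator_inv {A B C D : Mon V} (M : Bimod A B) (N : Bimod B C) (P : Bimod C D) :
    M.X ◁ tπ N P ≫ tπ M (N.tensorBimod P) ≫ (Bimod.associatorBimod M N P).inv.hom =
     (α_ _ _ _).inv ≫ tπ M N ▷ P.X ≫ tπ (M.tensorBimod N) P := by
  have : tπ M (N.tensorBimod P) ≫ (Bimod.associatorBimod M N P).inv.hom = Bimod.AssociatorBimod.invAux M N P := coequalizer.π_desc _ _
  rw [this]
  exact id_tensor_π_preserves_coequalizer_inv_desc _ _ _ _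

variable {A B C : Mon V} (φ : A ⟶ B)

/-- The map `N ⟶ B ⊗_B N`, `n ↦ 1 ⊗ n`. -/
noncomputable def extι (N : Bimod B C) : N.X ⟶ ((extBimod φ).tensorBimod N).X :=
  (λ_ N.X).inv ≫ η[B.X] ▷ N.X ≫ tπ (extBimod φ) N

theorem tπ_ext_eq (N : Bimod B C) : tπ (extBimod φ) N = N.actLeft ≫ extι φ N := by
  have h := tπ_condition (extBimod φ) N
  dsimp only [extBimod_X, extBimod_actRight] at h
  have h2 := congrArg (fun t => (λ_ (B.X ⊗ N.X)).inv ≫ η[B.X] ▷ (B.X ⊗ N.X) ≫ (α_ _ _ _).inv ≫ t) h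
  dsimp only [extι] at h2 ⊢
  simp only [Iso.inv_hom_id_assoc] at h2
  rw [leftUnitor_inv_naturality_assoc, whisker_exchange_assoc, ← h2]
  have h3 : η[B.X] ▷ (B.X ⊗ N.X) ≫ (α_ _ _ _).inv = (α_ _ _ _).inv ≫ (η[B.X] ▷ B.X) ▷ N.X := by simp
  rw [reassoc_of% h3, ← comp_whiskerRight_assoc, MonObj.one_mul]
  simp

theorem extι_actLeft (N : Bimod B C) : A.X ◁ extι φ N ≫ ((extBimod φ).tensorBimod N).actLeft =
    φ.hom ▷ N.X ≫ N.actLeft ≫ extι φ N := by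
  rw [← tπ_ext_eq]
  dsimp only [extι]
  simp only [MonoidalCategory.whiskerLeft_comp, Category.assoc]
  rw [tπ_actLeft]
  dsimp only [extBimod_X, extBimod_actLeft]
  have h : A.X ◁ η[B.X] ▷ N.X ≫ (α_ A.X B.X N.X).inv = (α_ _ _ _).inv ≫ (A.X ◁ η[B.X]) ▷ N.X := by simp
  rw [reassoc_of% h, ← comp_whiskerRight_assoc, whisker_exchange_assoc, MonObj.mul_one]
  simp

theorem extι_actRight (N : Bimod B C) : extι φ N ▷ C.X ≫ ((extBimod φ).tensorBimod N).actRight =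
    N.actRight ≫ extι φ N := by
  dsimp only [extι]
  simp only [comp_whiskerRight, Category.assoc]
  rw [tπ_actRight, leftUnitor_inv_naturality_assoc, whisker_exchange_assoc]
  simp


/-- The coevaluation `A ⟶ B ⊗_B B`, `a ↦ 1 ⊗ φ(a)`. -/
noncomputable def unitBimodHom : Bimod.regular A ⟶ (extBimod φ).tensorBimod (resBimod φ) :=
  Bimod.Hom.mk (show A.X ⟶ ((extBimod φ).tensorBimod (resBimod φ)).X from φ.hom ≫ extι φ (resBimod φ))
    (by
      change μ[A.X] ≫ φ.hom ≫ extι φ (resBimod φ) = A.X ◁ (φ.hom ≫ extι φ (resBimod φ)) ≫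
        ((extBimod φ).tensorBimod (resBimod φ)).actLeft
      rw [MonoidalCategory.whiskerLeft_comp, Category.assoc, extι_actLeft,
        IsMonHom.mul_hom_assoc, tensorHom_def'_assoc])
    (by
      change μ[A.X] ≫ φ.hom ≫ extι φ (resBimod φ) = (φ.hom ≫ extι φ (resBimod φ)) ▷ A.X ≫
        ((extBimod φ).tensorBimod (resBimod φ)).actRight
      rw [comp_whiskerRight, Category.assoc, extι_actRight,
        IsMonHom.mul_hom_assoc, MonoidalCategory.tensorHom_def]
      simp)

/-- The map `B ⊗_A B ⟶ B` induced by the multiplication. -/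
noncomputable def counitHom : ((resBimod φ).tensorBimod (extBimod φ)).X ⟶ B.X :=
  coequalizer.desc μ[B.X] (by simp)

theorem tπ_counitHom : tπ (resBimod φ) (extBimod φ) ≫ counitHom φ = μ[B.X] :=
  coequalizer.π_desc _ _

/-- The evaluation `B ⊗_A B ⟶ B`, as a map of bimodules. -/
noncomputable def counitBimodHom : (resBimod φ).tensorBimod (extBimod φ) ⟶ Bimod.regular B :=
  Bimod.Hom.mk (counitHom φ)
    (by
      change ((resBimod φ).tensorBimod (extBimod φ)).actLeft ≫ counitHom φ =
        B.X ◁ counitHom φ ≫ μ[B.X]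
      apply tπ_whiskerL_ext
      rw [reassoc_of% tπ_actLeft, tπ_counitHom, ← MonoidalCategory.whiskerLeft_comp_assoc, tπ_counitHom]
      simp)
    (by
      change ((resBimod φ).tensorBimod (extBimod φ)).actRight ≫ counitHom φ =
        counitHom φ ▷ B.X ≫ μ[B.X]
      apply tπ_whisker_ext
      rw [reassoc_of% tπ_actRight, tπ_counitHom, ← comp_whiskerRight_assoc, tπ_counitHom]
      simp)

theorem ext_res_left_triangle : Bimod.whiskerRight (unitBimodHom φ) (extBimod φ) ≫ (Bimod.associatorBimod _ _ _).hom ≫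
   Bimod.whiskerLeft (extBimod φ) (counitBimodHom φ) ≫ (Bimod.rightUnitorBimod (extBimod φ)).hom =
   (Bimod.leftUnitorBimod (extBimod φ)).hom := by
  apply Bimod.hom_ext
  apply tπ_ext
  change tπ (Bimod.regular A) (extBimod φ) ≫ (Bimod.whiskerRight (unitBimodHom φ) (extBimod φ)).hom ≫
    (Bimod.associatorBimod (extBimod φ) (resBimod φ) (extBimod φ)).hom.hom ≫
   (Bimod.whiskerLeft (extBimod φ) (counitBimodHom φ)).hom ≫ (Bimod.rightUnitorBimod (extBimod φ)).hom.hom =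
   tπ (Bimod.regular A) (extBimod φ) ≫ (Bimod.leftUnitorBimod (extBimod φ)).hom.hom
  rw [tπ_leftUnitor, reassoc_of% tπ_whiskerRight]
  change (φ.hom ≫ (λ_ B.X).inv ≫ η[B.X] ▷ B.X ≫ tπ (extBimod φ) (resBimod φ)) ▷ B.X ≫ _ = φ.hom ▷ B.X ≫ μ[B.X]
  simp only [comp_whiskerRight, Category.assoc]
  rw [reassoc_of% (tπ_associator (extBimod φ) (resBimod φ) (extBimod φ)), reassoc_of% tπ_whiskerLeft]
  change _ ≫ _ ≫ _ ≫ _ ≫ B.X ◁ tπ (resBimod φ) (extBimod φ) ≫ B.X ◁ counitHom φ ≫ _ = _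
  rw [tπ_rightUnitor]
  change _ ≫ _ ≫ _ ≫ _ ≫ B.X ◁ tπ (resBimod φ) (extBimod φ) ≫ B.X ◁ counitHom φ ≫ μ[B.X] = _
  rw [← MonoidalCategory.whiskerLeft_comp_assoc, tπ_counitHom]
  have h1 : η[B.X] ▷ B.X ▷ B.X ≫ (α_ B.X B.X B.X).hom =
      (α_ (𝟙_ V) B.X B.X).hom ≫ η[B.X] ▷ (B.X ⊗ B.X) := by simp
  have h2 : η[B.X] ▷ (B.X ⊗ B.X) ≫ B.X ◁ μ[B.X] = 𝟙_ V ◁ μ[B.X] ≫ η[B.X] ▷ B.X :=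
    (whisker_exchange _ _).symm
  rw [reassoc_of% h1, reassoc_of% h2, MonObj.one_mul]
  simp

theorem ext_res_right_triangle : Bimod.whiskerLeft (resBimod φ) (unitBimodHom φ) ≫ (Bimod.associatorBimod _ _ _).inv ≫
   Bimod.whiskerRight (counitBimodHom φ) (resBimod φ) ≫ (Bimod.leftUnitorBimod (resBimod φ)).hom =
   (Bimod.rightUnitorBimod (resBimod φ)).hom := by
  apply Bimod.hom_ext
  apply tπ_ext
  change tπ (resBimod φ) (Bimod.regular A) ≫ (Bimod.whiskerLeft (resBimod φ) (unitBimodHom φ)).hom ≫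
    (Bimod.associatorBimod (resBimod φ) (extBimod φ) (resBimod φ)).inv.hom ≫
   (Bimod.whiskerRight (counitBimodHom φ) (resBimod φ)).hom ≫ (Bimod.leftUnitorBimod (resBimod φ)).hom.hom =
   tπ (resBimod φ) (Bimod.regular A) ≫ (Bimod.rightUnitorBimod (resBimod φ)).hom.hom
  rw [tπ_rightUnitor, reassoc_of% tπ_whiskerLeft]
  change B.X ◁ (φ.hom ≫ (λ_ B.X).inv ≫ η[B.X] ▷ B.X ≫ tπ (extBimod φ) (resBimod φ)) ≫ _ = B.X ◁ φ.hom ≫ μ[B.X]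
  simp only [MonoidalCategory.whiskerLeft_comp, Category.assoc]
  rw [reassoc_of% (tπ_associator_inv (resBimod φ) (extBimod φ) (resBimod φ)), reassoc_of% tπ_whiskerRight]
  change _ ≫ _ ≫ _ ≫ _ ≫ tπ (resBimod φ) (extBimod φ) ▷ B.X ≫ counitHom φ ▷ B.X ≫ _ = _
  rw [tπ_leftUnitor]
  change _ ≫ _ ≫ _ ≫ _ ≫ tπ (resBimod φ) (extBimod φ) ▷ B.X ≫ counitHom φ ▷ B.X ≫ μ[B.X] = _
  rw [← comp_whiskerRight_assoc, tπ_counitHom]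
  have h1 : B.X ◁ η[B.X] ▷ B.X ≫ (α_ B.X B.X B.X).inv =
      (α_ B.X (𝟙_ V) B.X).inv ≫ (B.X ◁ η[B.X]) ▷ B.X := by simp
  rw [reassoc_of% h1, ← comp_whiskerRight_assoc, MonObj.mul_one]
  simp

variable (V) in
/-- The bicategory whose objects are the algebras (monoids) in `V`, whose 1-cells `A ⟶ B` are the
`A`-`B`-bimodules, composed by tensoring over the middle algebra, and whose 2-cells are the maps of
bimodules. (A type synonym, since `Mon V` already carries the category of algebra morphisms.) -/
def AlgBimod : Type max u v := Mon V

noncomputable instance : Bicategory (AlgBimod V) := Bimod.monBicategory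

/-- An algebra as an object of the bicategory of bimodules. -/
def toAlg (A : Mon V) : AlgBimod V := A

/-- Right `A`-modules, i.e. `𝟙`-`A`-bimodules: the left action of the unit algebra on a bimodule is
necessarily the left unitor, see `unit_actLeft`. -/
abbrev RightMod (A : Mon V) := toAlg (Mon.trivial V) ⟶ toAlg A

/-- The forgetful functor from right `A`-modules to `V`. -/
def forgetMod (A : Mon V) : RightMod A ⥤ V :=
  (Bimod.forget (Mon.trivial V) : Bimod (Mon.trivial V) A ⥤ V)

/-- The right `A`-module underlying an `S`-`A`-bimodule, as a bimodule over the unit algebra. -/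
def bimodToRight {S A : Mon V} (M : Bimod S A) : Bimod (Mon.trivial V) A where
  X := M.X
  actLeft := (λ_ M.X).hom
  actRight := M.actRight
  one_actLeft := by
    change 𝟙 (𝟙_ V) ▷ M.X ≫ _ = _
    simp
  left_assoc := by
    change (λ_ (𝟙_ V)).hom ▷ M.X ≫ (λ_ M.X).hom =
      (α_ (𝟙_ V) (𝟙_ V) M.X).hom ≫ 𝟙_ V ◁ (λ_ M.X).hom ≫ (λ_ M.X).hom
    monoidal
  actRight_one := M.actRight_one
  right_assoc := M.right_assoc
  middle_assoc := by
    change (λ_ M.X).hom ▷ A.X ≫ M.actRight =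
      (α_ (𝟙_ V) M.X A.X).hom ≫ 𝟙_ V ◁ M.actRight ≫ (λ_ M.X).hom
    rw [leftUnitor_naturality]
    simp

/-- The map of right modules underlying a map of bimodules. -/
def bimodToRightMap {S A : Mon V} {M N : Bimod S A} (g : M ⟶ N) :
    bimodToRight M ⟶ bimodToRight N :=
  Bimod.Hom.mk g.hom (leftUnitor_naturality g.hom).symm g.right_act_hom

/-- The forgetful functor from `S`-`A`-bimodules to right `A`-modules. -/
def underlyingRight (S A : Mon V) : (toAlg S ⟶ toAlg A) ⥤ RightMod A where
  obj M := bimodToRight (S := S) (A := A) M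
  map g := bimodToRightMap (S := S) (A := A) g
  map_id _ := rfl
  map_comp _ _ := rfl

/-- The algebra `A` as a right module over itself. -/
noncomputable def regularRight (A : Mon V) : RightMod A :=
  (underlyingRight A A).obj (𝟙 (toAlg A))

/-- A coring over `A`: a coalgebra in the monoidal category of `A`-bimodules. -/
abbrev Coring (A : Mon V) := Comon (EndMonoidal (toAlg A))

/-- The category of right `(A, C)`-comodules. -/
abbrev Comod {A : Mon V} (C : Coring A) := ComodCat (toAlg (Mon.trivial V)) C

/-- The forgetful functor from `(A, C)`-comodules to right `A`-modules. -/
noncomputable abbrev forgetComod {A : Mon V} (C : Coring A) : Comod C ⥤ RightMod A :=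
  (tensorComonad (toAlg (Mon.trivial V)) C).forget

/-- For an `A`-`S`-bimodule `N`, the functor `- ⊗_A N` from right `A`-modules to `V`. It only
depends on the left `A`-module underlying `N`. -/
noncomputable def tensorFunctor {A S : Mon V} (N : toAlg A ⟶ toAlg S) : RightMod A ⥤ V :=
  Bicategory.postcomp (toAlg (Mon.trivial V)) N ⋙ forgetMod S

/-- A coring `(A, C)` is flat if `- ⊗_A C` from right `A`-modules to `V` preserves coreflexive
equalizers. -/
def IsFlatCoring {A : Mon V} (C : Coring A) : Prop :=
  ∀ ⦃M N : RightMod A⦄ (f g : M ⟶ N) [IsCoreflexivePair f g],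
    PreservesLimit (parallelPair f g) (tensorFunctor (A := A) (S := A) C.X)

section

variable {A B : Mon V} (φ : A ⟶ B)

/-- `_A B_B` as a 1-cell of the bicategory of bimodules. -/
def ext : toAlg A ⟶ toAlg B := extBimod φ

/-- `_B B_A` as a 1-cell of the bicategory of bimodules. -/
def res : toAlg B ⟶ toAlg A := resBimod φ

/-- `_B B_A` is the right dual of `_A B_B`. -/
noncomputable def extResAdjunction : Bicategory.Adjunction (ext φ) (res φ) :=
  adjunctionOfTriangles (𝓑 := AlgBimod V) (f := ext φ) (g := res φ)
    (unitBimodHom φ) (counitBimodHom φ) (ext_res_left_triangle φ) (ext_res_right_triangle φ)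

/-- Extension of scalars `- ⊗_A B` along `φ : A ⟶ B`. -/
noncomputable def extendScalars : RightMod A ⥤ RightMod B :=
  Bicategory.postcomp (toAlg (Mon.trivial V)) (ext φ)

variable (C : Coring A)

/-- The `B`-coring `B_*(C) = φ_*(C) = B ⊗_A C ⊗_A B`. A morphism of corings `(A, C) ⟶ (B, D)` is an
algebra morphism `φ : A ⟶ B` together with a morphism of `B`-corings `pushCoring φ C ⟶ D`. -/
noncomputable def pushCoring : Coring B := canonicalCoring (extResAdjunction φ) C

/-- The universal braiding of `_A B_B` relative to `C` and `B_*(C)`. -/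
noncomputable def canonicalBraiding : Braiding C (pushCoring φ C) (ext φ) :=
  univBraiding (extResAdjunction φ) C

variable {C} {D : Coring B}

/-- The braiding `C ⊗_A B ⟶ B ⊗_A C ⊗_A B ⟶ D ≅ B ⊗_B D` of `_A B_B` associated with a morphism of
corings `(φ, f)`: the first map is induced by `φ` and the second one is `f`. -/
noncomputable def homBraiding (f : pushCoring φ C ⟶ D) : Braiding C D (ext φ) :=
  (canonicalBraiding φ C).compHom f

variable (C) in
/-- The left adjoint of the canonical adjunction, sending `M` to `M ⊗_A B`. -/
noncomputable def can : Comod C ⥤ Comod (pushCoring φ C) :=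
  (canonicalBraiding φ C).functor (toAlg (Mon.trivial V))

/-- The left adjoint of the adjunction governed by a morphism of corings `(φ, f)`, sending `M` to
`M ⊗_A B`. -/
noncomputable def homFunctor (f : pushCoring φ C ⟶ D) : Comod C ⥤ Comod D :=
  (homBraiding φ f).functor (toAlg (Mon.trivial V))

/-- The left adjoint `g_*` of the change-of-corings adjunction. -/
noncomputable def corestrict {C' : Coring A} (g : C ⟶ C') : Comod C ⥤ Comod C' :=
  changeOfCorings (toAlg (Mon.trivial V)) g

instance [HasCoreflexiveEqualizers (Comod C)] : (can φ C).IsLeftAdjoint :=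
  (canonicalBraiding φ C).isLeftAdjoint_functor (extResAdjunction φ)

instance [HasCoreflexiveEqualizers (Comod C)] (f : pushCoring φ C ⟶ D) :
    (homFunctor φ f).IsLeftAdjoint :=
  (homBraiding φ f).isLeftAdjoint_functor (extResAdjunction φ)

instance [HasCoreflexiveEqualizers (Comod C)] {C' : Coring A} (g : C ⟶ C') :
    (corestrict g).IsLeftAdjoint :=
  isLeftAdjoint_changeOfCorings g

instance : (extendScalars φ).IsLeftAdjoint :=
  (postcompAdjunction (extResAdjunction φ) _).isLeftAdjoint

end

end

end Algebras

/-! ## Model structures -/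

section Quillen

variable {𝓒 : Type*} [Category* 𝓒] [ModelCategory 𝓒] {𝓓 : Type*} [Category* 𝓓] [ModelCategory 𝓓]

/-- A left Quillen functor: a left adjoint preserving cofibrations and trivial cofibrations. -/
structure IsLeftQuillen (F : 𝓒 ⥤ 𝓓) : Prop where
  isLeftAdjoint : F.IsLeftAdjoint
  cofibration : ∀ ⦃X Y : 𝓒⦄ (i : X ⟶ Y), Cofibration i → Cofibration (F.map i)
  trivialCofibration : ∀ ⦃X Y : 𝓒⦄ (i : X ⟶ Y), Cofibration i → WeakEquivalence i →
    WeakEquivalence (F.map i)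

/-- A Quillen equivalence: a Quillen adjunction such that, for `X` cofibrant and `Y` fibrant, a map
`F X ⟶ Y` is a weak equivalence if and only if its adjunct `X ⟶ G Y` is one. -/
structure IsQuillenEquivalence {F : 𝓒 ⥤ 𝓓} {G : 𝓓 ⥤ 𝓒} (adj : F ⊣ G) : Prop where
  isLeftQuillen : IsLeftQuillen F
  weakEquivalence_iff : ∀ (X : 𝓒) (Y : 𝓓), IsCofibrant X → IsFibrant Y → ∀ f : F.obj X ⟶ Y,
    WeakEquivalence f ↔ WeakEquivalence (adj.homEquiv X Y f)

/-- The model structure on `𝓒` is left-induced along `U : 𝓒 ⥤ 𝓓`: weak equivalences and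
cofibrations (hence all three classes) are created by `U`. -/
structure IsLeftInduced (U : 𝓒 ⥤ 𝓓) : Prop where
  weakEquivalence_iff : ∀ ⦃X Y : 𝓒⦄ (f : X ⟶ Y), WeakEquivalence f ↔ WeakEquivalence (U.map f)
  cofibration_iff : ∀ ⦃X Y : 𝓒⦄ (f : X ⟶ Y), Cofibration f ↔ Cofibration (U.map f)

variable (𝓒) in
/-- The compatibility axiom of a (symmetric) monoidal model category: the pushout-product of two
cofibrations is a cofibration, which is trivial if one of the two is. -/
class IsMonoidalModelCategory [MonoidalCategory 𝓒] : Prop where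
  cofibration_pushoutProduct : ∀ ⦃K L X Y : 𝓒⦄ (j : K ⟶ L) (i : X ⟶ Y), Cofibration j →
    Cofibration i →
      Cofibration ((MonoidalCategory.Arrow.pushoutProduct.obj (Arrow.mk j)).obj (Arrow.mk i)).hom
  weakEquivalence_pushoutProduct : ∀ ⦃K L X Y : 𝓒⦄ (j : K ⟶ L) (i : X ⟶ Y), Cofibration j →
    Cofibration i → (WeakEquivalence j ∨ WeakEquivalence i) →
      WeakEquivalence
        ((MonoidalCategory.Arrow.pushoutProduct.obj (Arrow.mk j)).obj (Arrow.mk i)).hom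

end Quillen

section Homotopical

open Limits MonoidalCategory

variable {V : Type u} [Category.{v} V] [MonoidalCategory V]

/-- In a closed monoidal category, tensoring on the left preserves colimits. -/
instance [MonoidalClosed V] (X : V) : PreservesColimitsOfSize.{0, 0} (tensorLeft X) :=
  (Adjunction.ofIsLeftAdjoint (tensorLeft X)).leftAdjoint_preservesColimits

/-- In a closed symmetric monoidal category, tensoring on the right preserves colimits. -/
instance [MonoidalClosed V] [BraidedCategory V] (X : V) :
    PreservesColimitsOfSize.{0, 0} (tensorRight X) :=
  (Adjunction.ofIsLeftAdjoint (tensorRight X)).leftAdjoint_preservesColimits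

variable [HasCoequalizers V] [∀ X : V, PreservesColimitsOfSize.{0, 0} (tensorLeft X)]
  [∀ X : V, PreservesColimitsOfSize.{0, 0} (tensorRight X)]

/-- The left `A`-module underlying a bimodule `N` is homotopy flat if `- ⊗_A N`, from right
`A`-modules to `V`, preserves weak equivalences. -/
def IsHomotopyFlat {A S : Mon V} [ModelCategory V] [ModelCategory (RightMod A)]
    (N : toAlg A ⟶ toAlg S) : Prop :=
  ∀ ⦃M M' : RightMod A⦄ (g : M ⟶ M'), WeakEquivalence g →
    WeakEquivalence ((tensorFunctor N).map g)

/-- The left `A`-module underlying a bimodule `N` is strongly homotopy flat if it is homotopy flat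
and, for every finite diagram `Φ` of right `A`-modules, the natural map
`(lim Φ) ⊗_A N ⟶ lim (Φ ⊗_A N)` is a weak equivalence in `V`. -/
structure IsStronglyHomotopyFlat {A S : Mon V} [ModelCategory V] [ModelCategory (RightMod A)]
    (N : toAlg A ⟶ toAlg S) : Prop where
  isHomotopyFlat : IsHomotopyFlat N
  weakEquivalence_limit_post : ∀ (J : Type) [SmallCategory J] [FinCategory J] (Φ : J ⥤ RightMod A),
    WeakEquivalence (limit.post Φ (tensorFunctor N))

variable {A B : Mon V} (φ : A ⟶ B) {C : Coring A} {D : Coring B}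

variable (C) in
/-- The algebra morphism `φ : A ⟶ B` satisfies effective homotopic descent with respect to `C` if
the canonical adjunction between `(A, C)`-comodules and `(B, B_*(C))`-comodules is a Quillen
equivalence. -/
def SatisfiesEffectiveHomotopicDescent [ModelCategory (Comod C)]
    [ModelCategory (Comod (pushCoring φ C))] : Prop :=
  IsQuillenEquivalence (Adjunction.ofIsLeftAdjoint (can φ C))

/-- The adjunction `(T_{φ,f})_* ⊣ (T_{φ,f})^*` governed by a morphism of corings `(φ, f)`. -/
noncomputable def homAdjunction [ModelCategory (Comod C)] (f : pushCoring φ C ⟶ D) :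
    homFunctor φ f ⊣ (homFunctor φ f).rightAdjoint :=
  Adjunction.ofIsLeftAdjoint (homFunctor φ f)

/-- The change-of-corings adjunction `g_* ⊣ g^*`. -/
noncomputable def corestrictAdjunction {C' : Coring A} [ModelCategory (Comod C)] (g : C ⟶ C') :
    corestrict g ⊣ (corestrict g).rightAdjoint :=
  Adjunction.ofIsLeftAdjoint (corestrict g)

/-- A morphism `g : C ⟶ C'` of `A`-corings is a copure weak equivalence if it is a weak equivalence
(of right `A`-modules) and the counit `g_* g^* M ⟶ M` of the change-of-corings adjunction is a weak
equivalence for every fibrant `C'`-comodule `M`. -/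
structure IsCopureWeakEquivalence {C' : Coring A} [ModelCategory (RightMod A)]
    [ModelCategory (Comod C)] [ModelCategory (Comod C')] (g : C ⟶ C') : Prop where
  weakEquivalence : WeakEquivalence ((underlyingRight A A).map g.hom)
  weakEquivalence_counit : ∀ M : Comod C', IsFibrant M →
    WeakEquivalence ((corestrictAdjunction g).counit.app M)

end Homotopical

end CoringMorita

open CategoryTheory HomotopicalAlgebra CoringMorita

namespace CoringMorita

/-! ### Quillen adjunctions and criteria for Quillen equivalences. -/

section Quillen

open Limits

variable {𝓒 : Type*} [Category* 𝓒] [ModelCategory 𝓒] {𝓓 : Type*} [Category* 𝓓] [ModelCategory 𝓓]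
  {𝓔 : Type*} [Category* 𝓔] [ModelCategory 𝓔]

/-! The functor attached to `(φ, f)` factors, up to isomorphism, as `can φ C` followed by
`corestrict f` (`Braiding.functorCompHomIso`), so everything is a comparison between a composite
Quillen adjunction and its two factors. Since `corestrict f` leaves underlying modules alone, it
preserves and reflects weak equivalences. For such a left adjoint, being a Quillen equivalence only
requires the counit to be a weak equivalence at fibrant objects (`IsQuillenEquivalence.of_counit`).
A copure weak equivalence therefore yields a Quillen equivalence, and the first assertion follows by
composing.

For the converse, the key point is that the counit of the canonical adjunction is a weak equivalence
at every comodule (`weakEquivalence_counit_can`). At a cofree comodule it is even an isomorphism,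
since `can` sends the cofree `C`-comodule on the restriction of `M` to the cofree `B_*(C)`-comodule
on `M`. A general comodule is the coreflexive equalizer of its Beck fork of cofree comodules. The
right adjoint preserves this equalizer, flatness of `C` lets the forgetful functor preserve the
result, and strong homotopy flatness of `B` lets `- ⊗_A B` preserve it up to weak equivalence. On
the other side the fork becomes split after forgetting the coaction, hence stays an equalizer in
`V`.

Homotopy flatness makes the composite functor preserve all weak equivalences. Being part of a
Quillen equivalence, it then reflects them too, and its counit is a weak equivalence at fibrant
objects. Hence `can` reflects weak equivalences and is a Quillen equivalence by the counit
criterion, while two-out-of-three gives the counit condition for `f`. That `f` is itself a weak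
equivalence is read off from this counit at the cofree `D`-comodule on `B`, where it is `B ⊗_B f`.
-/

theorem exists_cofibrant_replacement (X : 𝓒) :
    ∃ (Q : 𝓒) (p : Q ⟶ X), IsCofibrant Q ∧ Fibration p ∧ WeakEquivalence p := by
  let h := MorphismProperty.factorizationData (cofibrations 𝓒) (trivialFibrations 𝓒) (initial.to X)
  have hi : Cofibration h.i := (cofibration_iff _).2 h.hi
  have hp := (mem_trivialFibrations_iff h.p).1 h.hp
  exact ⟨h.Z, h.p, (isCofibrant_iff_of_isInitial h.i initialIsInitial).2 hi, hp.1, hp.2⟩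

theorem exists_fibrant_replacement (X : 𝓒) :
    ∃ (R : 𝓒) (i : X ⟶ R), IsFibrant R ∧ WeakEquivalence i := by
  let h := MorphismProperty.factorizationData (trivialCofibrations 𝓒) (fibrations 𝓒)
    (terminal.from X)
  have hp : Fibration h.p := (fibration_iff _).2 h.hp
  have hi := (mem_trivialCofibrations_iff h.i).1 h.hi
  exact ⟨h.Z, h.i, (isFibrant_iff_of_isTerminal h.p terminalIsTerminal).2 hp, hi.2⟩

namespace IsLeftQuillen

variable {F : 𝓒 ⥤ 𝓓} {G : 𝓓 ⥤ 𝓒}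

theorem comp (hF : IsLeftQuillen F) {K : 𝓓 ⥤ 𝓔} (hK : IsLeftQuillen K) :
    IsLeftQuillen (F ⋙ K) where
  isLeftAdjoint :=
    have := hF.isLeftAdjoint
    have := hK.isLeftAdjoint
    inferInstance
  cofibration _ _ i hi := hK.cofibration _ (hF.cofibration i hi)
  trivialCofibration _ _ i hi hi' :=
    hK.trivialCofibration _ (hF.cofibration i hi) (hF.trivialCofibration i hi hi')

theorem isCofibrant_obj (hF : IsLeftQuillen F) (X : 𝓒) [hX : IsCofibrant X] :
    IsCofibrant (F.obj X) := by
  have := hF.isLeftAdjoint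
  exact (isCofibrant_iff_of_isInitial (F.map (initial.to X))
    (IsInitial.isInitialObj F _ initialIsInitial)).2 (hF.cofibration _ hX)

theorem fibration_map (hF : IsLeftQuillen F) (adj : F ⊣ G) {X Y : 𝓓} (p : X ⟶ Y)
    [Fibration p] : Fibration (G.map p) := by
  rw [fibration_iff, ← MorphismProperty.rlp_eq_of_wfs (trivialCofibrations 𝓒) (fibrations 𝓒)]
  intro A B i hi
  obtain ⟨_, _⟩ := (mem_trivialCofibrations_iff i).1 hi
  rw [← adj.hasLiftingProperty_iff]
  have := hF.cofibration i inferInstance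
  have := hF.trivialCofibration i inferInstance inferInstance
  infer_instance

theorem isFibrant_obj (hF : IsLeftQuillen F) (adj : F ⊣ G) (Y : 𝓓) [hY : IsFibrant Y] :
    IsFibrant (G.obj Y) := by
  have := adj.isRightAdjoint
  exact (isFibrant_iff_of_isTerminal (G.map (terminal.from Y))
    (IsTerminal.isTerminalObj G _ terminalIsTerminal)).2 (hF.fibration_map adj _)

theorem of_iso {F' : 𝓒 ⥤ 𝓓} (hF : IsLeftQuillen F) (e : F ≅ F') : IsLeftQuillen F' where
  isLeftAdjoint :=
    have := hF.isLeftAdjoint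
    Functor.isLeftAdjoint_of_iso e
  cofibration _ _ i hi := by
    have h := hF.cofibration i hi
    rw [cofibration_iff] at h ⊢
    exact ((cofibrations 𝓓).arrow_mk_iso_iff
      (((Functor.mapArrowFunctor _ _).mapIso e).app (.mk i))).1 h
  trivialCofibration _ _ i hi hi' := by
    have h := hF.trivialCofibration i hi hi'
    rw [weakEquivalence_iff] at h ⊢
    exact ((weakEquivalences 𝓓).arrow_mk_iso_iff
      (((Functor.mapArrowFunctor _ _).mapIso e).app (.mk i))).1 h

end IsLeftQuillen

namespace IsQuillenEquivalence

variable {F : 𝓒 ⥤ 𝓓} {G : 𝓓 ⥤ 𝓒} {adj : F ⊣ G}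

/-- Right adjoints are unique, so adjuncts for the two adjunctions differ only by isomorphisms. The
chosen right adjoint is therefore irrelevant. -/
theorem of_iso (h : IsQuillenEquivalence adj) {F' : 𝓒 ⥤ 𝓓} {G' : 𝓓 ⥤ 𝓒} (e : F ≅ F')
    (adj' : F' ⊣ G') : IsQuillenEquivalence adj' where
  isLeftQuillen := h.isLeftQuillen.of_iso e
  weakEquivalence_iff X Y hX hY f := by
    let adj'' := adj'.ofNatIsoLeft e.symm
    have h1 : adj'.homEquiv X Y f = adj.homEquiv X Y (e.hom.app X ≫ f) ≫
        (adj.rightAdjointUniq adj'').hom.app Y := by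
      rw [adj.homEquiv_unit, Category.assoc, NatTrans.naturality,
        reassoc_of% (adj.unit_rightAdjointUniq_hom_app adj''),
        show adj''.unit.app X = adj'.unit.app X ≫ G'.map (e.inv.app X) from rfl, Category.assoc,
        ← G'.map_comp, Iso.inv_hom_id_app_assoc, adj'.homEquiv_unit]
    rw [h1, weakEquivalence_postcomp_iff, ← h.weakEquivalence_iff X Y hX hY,
      weakEquivalence_precomp_iff]

theorem comp (h : IsQuillenEquivalence adj) {K : 𝓓 ⥤ 𝓔} {H : 𝓔 ⥤ 𝓓} {adj' : K ⊣ H}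
    (h' : IsQuillenEquivalence adj') : IsQuillenEquivalence (adj.comp adj') where
  isLeftQuillen := h.isLeftQuillen.comp h'.isLeftQuillen
  weakEquivalence_iff X Y hX hY f := by
    have := h.isLeftQuillen.isCofibrant_obj X
    have := h'.isLeftQuillen.isFibrant_obj adj' Y
    rw [Adjunction.comp_homEquiv]
    exact (h'.weakEquivalence_iff _ _ inferInstance hY f).trans
      (h.weakEquivalence_iff _ _ hX inferInstance _)

/-- A map `f : F X ⟶ Y` is `F` of its adjunct followed by the counit. Two-out-of-three and `hw` then
compare `f` with its adjunct. -/
theorem of_counit (hF : IsLeftQuillen F)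
    (hw : ∀ ⦃X Y : 𝓒⦄ (g : X ⟶ Y), WeakEquivalence (F.map g) ↔ WeakEquivalence g)
    (hc : ∀ Y : 𝓓, IsFibrant Y → WeakEquivalence (adj.counit.app Y)) :
    IsQuillenEquivalence adj where
  isLeftQuillen := hF
  weakEquivalence_iff X Y _ hY f := by
    have := hc Y hY
    have h : F.map (adj.homEquiv X Y f) ≫ adj.counit.app Y = f :=
      (adj.homEquiv_counit _ _ _).symm.trans (Equiv.symm_apply_apply _ _)
    rw [← hw, ← weakEquivalence_postcomp_iff _ (adj.counit.app Y), h]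

variable (h : IsQuillenEquivalence adj)
  (hw : ∀ ⦃X Y : 𝓒⦄ (g : X ⟶ Y), WeakEquivalence g → WeakEquivalence (F.map g))
include h hw

/-- The derived counit is the composite `F Q ⟶ F G Y ⟶ Y` for a cofibrant replacement `Q` of `G Y`.
When `F` preserves all weak equivalences, the replacement can be dropped. -/
theorem weakEquivalence_counit (Y : 𝓓) (hY : IsFibrant Y) :
    WeakEquivalence (adj.counit.app Y) := by
  obtain ⟨Q, p, hQ, _, hp⟩ := exists_cofibrant_replacement (G.obj Y)
  have := hw p hp
  have h1 := (h.weakEquivalence_iff Q Y hQ hY ((adj.homEquiv Q Y).symm p)).2 (by simpa)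
  rw [adj.homEquiv_counit] at h1
  exact weakEquivalence_of_precomp (F.map p) _

/-- The left adjoint of a Quillen equivalence reflects weak equivalences between cofibrant objects.
As `F` preserves all weak equivalences, the general case reduces to cofibrant replacements. -/
theorem weakEquivalence_of_map {X Y : 𝓒} (g : X ⟶ Y) (hg : WeakEquivalence (F.map g)) :
    WeakEquivalence g := by
  obtain ⟨P, p, hP, _, hp⟩ := exists_cofibrant_replacement X
  obtain ⟨Q, q, hQ, _, hq⟩ := exists_cofibrant_replacement Y
  -- The source `P` is cofibrant and `q` is a trivial fibration, so `g` lifts to a map `P ⟶ Q`.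
  have sq : CommSq (initial.to Q) (initial.to P) q (p ≫ g) := ⟨Subsingleton.elim _ _⟩
  have := hw p hp
  have := hw q hq
  have hl : WeakEquivalence (F.map sq.lift) := by
    rw [← weakEquivalence_postcomp_iff _ (F.map q), ← F.map_comp, sq.fac_right, F.map_comp]
    infer_instance
  obtain ⟨R, r, hR, hr⟩ := exists_fibrant_replacement (F.obj Q)
  -- By naturality the adjunct of `F.map sq.lift ≫ r` is the lift followed by the adjunct of `r`.
  -- Both adjuncts are weak equivalences, hence so is the lift.
  have h1 := (h.weakEquivalence_iff _ _ hQ hR r).1 hr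
  have h2 := (h.weakEquivalence_iff _ _ hP hR (F.map sq.lift ≫ r)).1 inferInstance
  rw [adj.homEquiv_naturality_left, weakEquivalence_postcomp_iff] at h2
  rw [← weakEquivalence_precomp_iff p, ← sq.fac_right]
  infer_instance

end IsQuillenEquivalence

end Quillen

/-! ### Limits preserved up to weak equivalence, and coreflexive pairs. -/

section Limits

open Limits

/-- If `Θ` commutes with a limit up to weak equivalence, then the map from `Θ` of a limit cone to
any limit cone over an isomorphic diagram is a weak equivalence. -/
theorem weakEquivalence_of_limit_post {𝓐 𝓥 J : Type*} [Category* 𝓐] [Category* 𝓥] [Category* J]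
    [ModelCategory 𝓥] {Φ : J ⥤ 𝓐} {Θ : 𝓐 ⥤ 𝓥} [HasLimit Φ] [HasLimit (Φ ⋙ Θ)]
    (h : WeakEquivalence (limit.post Φ Θ)) {c : Cone Φ} (hc : IsLimit c) {Ψ : J ⥤ 𝓥}
    (α : Φ ⋙ Θ ≅ Ψ) {d : Cone Ψ} (hd : IsLimit d) (g : Θ.obj c.pt ⟶ d.pt)
    (w : ∀ j, g ≫ d.π.app j = Θ.map (c.π.app j) ≫ α.hom.app j) : WeakEquivalence g := by
  let e := hc.conePointUniqueUpToIso (limit.isLimit Φ)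
  let e' := (limit.isLimit (Φ ⋙ Θ)).conePointsIsoOfNatIso hd α
  -- Any such map is the comparison map for the chosen limits, up to the isomorphisms of cone
  -- points.
  have hg : g = Θ.map e.hom ≫ limit.post Φ Θ ≫ e'.hom := by
    refine hd.hom_ext fun j => ?_
    rw [w, Category.assoc, Category.assoc,
      IsLimit.conePointsIsoOfNatIso_hom_comp _ hd α j, limit.cone_π, limit.post_π_assoc,
      ← Θ.map_comp_assoc]
    congr 2
    exact (hc.conePointUniqueUpToIso_hom_comp (limit.isLimit Φ) j).symm
  rw [hg]
  infer_instance

theorem preservesLimit_of_preservesCoreflexiveEqualizers {𝓐 𝓑 : Type*} [Category* 𝓐] [Category* 𝓑]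
    (F : 𝓐 ⥤ 𝓑)
    (hF : ∀ ⦃X Y : 𝓐⦄ (f g : X ⟶ Y) [IsCoreflexivePair f g], PreservesLimit (parallelPair f g) F)
    (Φ : WalkingParallelPair ⥤ 𝓐)
    (hΦ : IsCoreflexivePair (Φ.map WalkingParallelPairHom.left)
      (Φ.map WalkingParallelPairHom.right)) :
    PreservesLimit Φ F :=
  have := @hF _ _ _ _ hΦ
  preservesLimit_of_iso_diagram F (diagramIsoParallelPair Φ).symm

theorem IsCoreflexivePair.map {𝓐 𝓑 : Type*} [Category* 𝓐] [Category* 𝓑] (F : 𝓐 ⥤ 𝓑) {X Y : 𝓐}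
    (f g : X ⟶ Y) [IsCoreflexivePair f g] : IsCoreflexivePair (F.map f) (F.map g) :=
  .mk' (F.map (commonRetraction f g))
    (by rw [← F.map_comp, left_comp_retraction, F.map_id])
    (by rw [← F.map_comp, right_comp_retraction, F.map_id])

end Limits

/-! ### Coalgebras over a comonad: equalizers and counits at cofree objects. -/

section Comonads

open Limits

variable {𝓐 𝓑 : Type*} [Category* 𝓐] [Category* 𝓑] {T : Comonad 𝓑}

/-- The forgetful functor creates those limits that are preserved by `T` and preserved again after
applying `T` to the diagram. Functors preserve coreflexive pairs, so `hT` covers both cases. -/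
theorem preservesLimit_comonad_forget [HasEqualizers 𝓑]
    (hT : ∀ ⦃X Y : 𝓑⦄ (f g : X ⟶ Y) [IsCoreflexivePair f g],
      PreservesLimit (parallelPair f g) T.toFunctor)
    (Φ : WalkingParallelPair ⥤ T.Coalgebra)
    (hΦ : IsCoreflexivePair (Φ.map WalkingParallelPairHom.left)
      (Φ.map WalkingParallelPairHom.right)) :
    PreservesLimit Φ T.forget := by
  have h1 := preservesLimit_of_preservesCoreflexiveEqualizers T.toFunctor hT (Φ ⋙ T.forget)
    (IsCoreflexivePair.map T.forget _ _)
  have h2 := preservesLimit_of_preservesCoreflexiveEqualizers T.toFunctor hT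
    ((Φ ⋙ T.forget) ⋙ T.toFunctor)
    (IsCoreflexivePair.map (T.forget ⋙ T.toFunctor) _ _)
  have := Comonad.forgetCreatesLimit Φ
  infer_instance

/-- A map into a cofree coalgebra is recovered from its adjunct `k.f ≫ T.ε.app X`. -/
theorem coalgebraHom_cofree_f {A : T.Coalgebra} {X : 𝓑} (k : A ⟶ T.cofree.obj X) :
    k.f = A.a ≫ T.map (k.f ≫ T.ε.app X) := by
  obtain ⟨(f : A.A ⟶ T.obj X), (h : A.a ≫ T.map f = f ≫ T.δ.app X)⟩ := k
  change f = A.a ≫ T.map (f ≫ T.ε.app X)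
  rw [T.map_comp, reassoc_of% h, T.right_counit, Category.comp_id]

/-- Both `H` and `T.cofree ⋙ G` are right adjoint to `F ⋙ T.forget`, hence isomorphic. This computes
the counit of `F ⊣ G` at cofree coalgebras when `G` itself is known only through an existence
theorem. -/
theorem exists_counit_cofree {F : 𝓐 ⥤ T.Coalgebra} {G : T.Coalgebra ⥤ 𝓐} (adj : F ⊣ G)
    {H : 𝓑 ⥤ 𝓐} (adj' : F ⋙ T.forget ⊣ H) (X : 𝓑) :
    ∃ e : H.obj X ≅ G.obj (T.cofree.obj X),
      (F.map e.hom ≫ adj.counit.app (T.cofree.obj X)).f =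
        (F.obj (H.obj X)).a ≫ T.map (adj'.counit.app X) := by
  refine ⟨(adj'.rightAdjointUniq (adj.comp T.adj)).app X, ?_⟩
  refine (coalgebraHom_cofree_f _).trans ?_
  congr 2
  have h : (adj.comp T.adj).counit.app X =
      (adj.counit.app (T.cofree.obj X)).f ≫ T.ε.app X := by
    rw [Adjunction.comp_counit_app, Comonad.adj_counit]
    rfl
  have h' := adj'.rightAdjointUniq_hom_app_counit (adj.comp T.adj) X
  rw [h] at h'
  exact (Category.assoc _ _ _).trans h'

/-- The Beck fork of a coalgebra is preserved by every functor that factors through the forgetful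
functor. -/
noncomputable def isLimitMapConeBeckCoalgebraFork {𝓥 : Type*} [Category* 𝓥] (K : 𝓑 ⥤ 𝓥)
    (N : T.Coalgebra) :
    IsLimit ((T.forget ⋙ K).mapCone (Comonad.beckCoalgebraFork N)) :=
  (isLimitMapConeForkEquiv (T.forget ⋙ K) (Comonad.CofreeEqualizer.condition N)).symm
    ((Comonad.beckSplitEqualizer N).map K).isEqualizer

/-- If `T.forget ⋙ K` sends the counit of `F ⊣ G` at cofree coalgebras to isomorphisms, and the
coreflexive equalizers needed to compute `G` from its values on cofree coalgebras are preserved up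
to weak equivalence, then it sends the counit to weak equivalences. -/
theorem weakEquivalence_counit_of_cofree {𝓐' 𝓥 : Type*} [Category* 𝓐'] [Category* 𝓥]
    [ModelCategory 𝓥] [HasEqualizers 𝓐']
    {F : 𝓐 ⥤ T.Coalgebra} {G : T.Coalgebra ⥤ 𝓐} (adj : F ⊣ G) (K : 𝓑 ⥤ 𝓥) (U : 𝓐 ⥤ 𝓐')
    (Θ : 𝓐' ⥤ 𝓥) (e : U ⋙ Θ ≅ F ⋙ T.forget ⋙ K)
    (hU : ∀ Φ : WalkingParallelPair ⥤ 𝓐, IsCoreflexivePair (Φ.map WalkingParallelPairHom.left)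
      (Φ.map WalkingParallelPairHom.right) → PreservesLimit Φ U)
    (hΘ : ∀ Φ : WalkingParallelPair ⥤ 𝓐', WeakEquivalence (limit.post Φ Θ))
    (hc : ∀ X, IsIso (adj.counit.app (T.cofree.obj X))) (N : T.Coalgebra) :
    WeakEquivalence ((T.forget ⋙ K).map (adj.counit.app N)) := by
  -- The counit, precomposed with `e`, is natural. On the arrows of the diagram this gives the
  -- naturality of `α`; on the leg of the Beck fork it identifies the counit at `N` with a limit
  -- comparison.
  have nat : ∀ {N N' : T.Coalgebra} (k : N ⟶ N'), Θ.map (U.map (G.map k)) ≫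
      e.hom.app (G.obj N') ≫ (T.forget ⋙ K).map (adj.counit.app N') =
        (e.hom.app (G.obj N) ≫ (T.forget ⋙ K).map (adj.counit.app N)) ≫ (T.forget ⋙ K).map k := by
    intro N N' k
    have h1 := e.hom.naturality (G.map k)
    have h2 := congrArg (T.forget ⋙ K).map (adj.counit.naturality k)
    rw [Functor.map_comp, Functor.map_comp] at h2
    exact ((reassoc_of% h1) _).trans ((congrArg (e.hom.app _ ≫ ·) h2).trans
      (Category.assoc _ _ _).symm)
  let Φ := parallelPair (Comonad.CofreeEqualizer.topMap N) (Comonad.CofreeEqualizer.bottomMap N)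
  have := adj.isRightAdjoint
  have := hU (Φ ⋙ G) (IsCoreflexivePair.map G (Comonad.CofreeEqualizer.topMap N)
    (Comonad.CofreeEqualizer.bottomMap N))
  -- `G` preserves the Beck equalizer as a right adjoint, and `U` preserves its image because the
  -- pair remains coreflexive.
  have hl := isLimitOfPreserves U (isLimitOfPreserves G (Comonad.beckCoalgebraEqualizer N))
  have hα : ∀ j, IsIso (adj.counit.app (Φ.obj j)) := by
    rintro (_ | _) <;> exact hc _
  let α : ((Φ ⋙ G) ⋙ U) ⋙ Θ ≅ Φ ⋙ T.forget ⋙ K :=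
    NatIso.ofComponents (fun j => e.app _ ≪≫ (T.forget ⋙ K).mapIso (asIso (adj.counit.app (Φ.obj j))))
      fun k => nat (Φ.map k)
  rw [← weakEquivalence_precomp_iff (e.hom.app _)]
  refine weakEquivalence_of_limit_post (hΘ _) hl α (isLimitMapConeBeckCoalgebraFork K N) _ ?_
  exact fun j => (nat ((Comonad.beckCoalgebraFork N).π.app j)).symm

end Comonads

/-! ### Counits at cofree comodules for the canonical and the change-of-corings adjunctions. -/

section Bicategory

open Bicategory

variable {𝓑 : Type u} [Bicategory.{w, v} 𝓑] {o a b : 𝓑}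

section

variable {X : a ⟶ b} {Y : b ⟶ a} (adj : Bicategory.Adjunction X Y) (C : Comon (EndMonoidal a))

/-- The coaction comultiplies `C` and inserts the coevaluation; the counit of the composite
adjunction kills the first copy of `C` and evaluates. Together they form `M` tensored with the left
counit law of `Y ⊗ C ⊗ X`, so only associators survive. -/
theorem univBraiding_cofree_counit (M : o ⟶ b) :
    coact (((univBraiding adj C).functor o).obj
        ((tensorComonad o C).cofree.obj ((postcomp o Y).obj M))) ≫
      (((tensorComonad o C).adj.comp (postcompAdjunction adj o)).counit.app M) ▷
        (canonicalCoring adj C).X =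
    (α_ (M ≫ Y) (C.X : a ⟶ a) X).hom ≫ (α_ M Y ((C.X : a ⟶ a) ≫ X)).hom := by
  have h := cComul_counit_left adj C.X (comulMap C) (counitMap C) (counit_comul C)
  have h1 : coact (((univBraiding adj C).functor o).obj
      ((tensorComonad o C).cofree.obj ((postcomp o Y).obj M))) =
      ((M ≫ Y) ◁ comulMap C ≫ (α_ (M ≫ Y) (C.X : a ⟶ a) C.X).inv) ▷ X ≫
        (α_ ((M ≫ Y) ≫ C.X) (C.X : a ⟶ a) X).hom ≫
        ((M ≫ Y) ≫ C.X) ◁ ((λ_ (C.X ≫ X)).inv ≫ adj.unit ▷ (C.X ≫ X) ≫ (α_ X Y (C.X ≫ X)).hom) ≫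
        (α_ ((M ≫ Y) ≫ C.X) X (Y ≫ C.X ≫ X)).inv := rfl
  have h2 : ((tensorComonad o C).adj.comp (postcompAdjunction adj o)).counit.app M =
    ((M ≫ Y) ◁ counitMap C ≫ (ρ_ _).hom) ▷ X ≫ (α_ M Y X).hom ≫ M ◁ adj.counit ≫ (ρ_ M).hom := by
    rw [Adjunction.comp_counit_app, Comonad.adj_counit]
    rfl
  rw [h1, h2]
  change ((((M ≫ Y) ◁ comulMap C ≫ (α_ (M ≫ Y) (C.X : a ⟶ a) C.X).inv) ▷ X ≫
        (α_ ((M ≫ Y) ≫ C.X) (C.X : a ⟶ a) X).hom ≫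
        ((M ≫ Y) ≫ C.X) ◁ ((λ_ (C.X ≫ X)).inv ≫ adj.unit ▷ (C.X ≫ X) ≫ (α_ X Y (C.X ≫ X)).hom) ≫
        (α_ ((M ≫ Y) ≫ C.X) X (Y ≫ C.X ≫ X)).inv :
          ((M ≫ Y) ≫ (C.X : a ⟶ a)) ≫ X ⟶ (((M ≫ Y) ≫ C.X) ≫ X) ≫ (Y ≫ C.X ≫ X))) ≫
    (((M ≫ Y) ◁ counitMap C ≫ (ρ_ _).hom) ▷ X ≫ (α_ M Y X).hom ≫ M ◁ adj.counit ≫ (ρ_ M).hom :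
      ((M ≫ Y) ≫ (C.X : a ⟶ a)) ≫ X ⟶ M) ▷ (Y ≫ C.X ≫ X) = _
  calc _ = 𝟙 _ ⊗≫ M ◁ (cComul adj C.X (comulMap C) ≫ cCounit adj C.X (counitMap C) ▷ (Y ≫ C.X ≫ X))
            ⊗≫ 𝟙 _ := by
        dsimp only [cComul, cCounit]
        bicategory
    _ = _ := by rw [h]; bicategory

/-- Up to an isomorphism of sources, the underlying map of the counit is a composite of associators,
and forgetting the coaction reflects isomorphisms. -/
theorem isIso_counit_univBraiding_cofree {G : ComodCat o (canonicalCoring adj C) ⥤ ComodCat o C}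
    (adj' : (univBraiding adj C).functor o ⊣ G) (M : o ⟶ b) :
    IsIso (adj'.counit.app ((tensorComonad o (canonicalCoring adj C)).cofree.obj M)) := by
  obtain ⟨e, he⟩ := exists_counit_cofree adj'
    ((tensorComonad o C).adj.comp (postcompAdjunction adj o)) M
  have h := he.trans (univBraiding_cofree_counit adj C M)
  set k := ((univBraiding adj C).functor o).map e.hom ≫
    adj'.counit.app ((tensorComonad o (canonicalCoring adj C)).cofree.obj M) with hk
  have : IsIso ((tensorComonad o (canonicalCoring adj C)).forget.map k) := by
    change IsIso k.f
    rw [h]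
    exact (α_ (M ≫ Y) (C.X : a ⟶ a) X ≪≫ α_ M Y ((C.X : a ⟶ a) ≫ X)).isIso_hom
  have := isIso_of_reflects_iso k (tensorComonad o (canonicalCoring adj C)).forget
  exact IsIso.of_isIso_comp_left (((univBraiding adj C).functor o).map e.hom) _

end

section

variable {C : Comon (EndMonoidal a)} {D D' : Comon (EndMonoidal b)}

/-- Sliding `g` past the counit of `D` leaves the comultiplication followed by that counit, which
cancel by the left counit law. -/
theorem changeOfCorings_cofree_counit (g : D ⟶ D') (M : o ⟶ b) :
    coact ((changeOfCorings o g).obj ((tensorComonad o D).cofree.obj M)) ≫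
      ((tensorComonad o D).adj.counit.app M) ▷ D'.X = M ◁ homMap g := by
  have h := congrArg (M ◁ ·) (counit_comul D)
  have h1 : (M ≫ D.X) ◁ homMap g ≫ (M ◁ counitMap D ≫ (ρ_ M).hom) ▷ D'.X =
      (M ◁ counitMap D ≫ (ρ_ M).hom) ▷ D.X ≫ M ◁ homMap g := whisker_exchange _ _
  rw [Comonad.adj_counit]
  change ((M ◁ comulMap D ≫ (α_ M D.X D.X).inv) ≫ (M ≫ D.X) ◁ homMap g) ≫
    (M ◁ counitMap D ≫ (ρ_ M).hom) ▷ D'.X = _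
  rw [Category.assoc, h1]
  simp only [whiskerLeft_comp] at h
  simp [reassoc_of% h]

theorem exists_counit_changeOfCorings_cofree (g : D ⟶ D') {G : ComodCat o D' ⥤ ComodCat o D}
    (adj : changeOfCorings o g ⊣ G) (M : o ⟶ b) :
    ∃ e : (tensorComonad o D).cofree.obj M ≅ G.obj ((tensorComonad o D').cofree.obj M),
      (tensorComonad o D').forget.map ((changeOfCorings o g).map e.hom ≫
        adj.counit.app ((tensorComonad o D').cofree.obj M)) = M ◁ homMap g := by
  obtain ⟨e, he⟩ := exists_counit_cofree adj (tensorComonad o D).adj M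
  exact ⟨e, he.trans (changeOfCorings_cofree_counit g M)⟩

/-- The functor governed by `T.compHom g` is the one governed by `T` followed by the change of
corings along `g`. -/
def Braiding.functorCompHomIso {X : a ⟶ b} (T : Braiding C D X) (g : D ⟶ D') :
    T.functor o ⋙ changeOfCorings o g ≅ (T.compHom g).functor o :=
  -- The underlying 1-cells agree on the nose; only the bracketing of the two coactions differs.
  NatIso.ofComponents (fun M => Comonad.Coalgebra.isoMk (Iso.refl (M.A ≫ X)) (by
      have h : (((coact M ▷ X ≫ (α_ M.A C.X X).hom ≫ M.A ◁ T.hom ≫ (α_ M.A X D.X).inv) ≫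
          (M.A ≫ X) ◁ homMap g)) ≫ 𝟙 (M.A ≫ X) ▷ D'.X = 𝟙 (M.A ≫ X) ≫ (coact M ▷ X ≫
            (α_ M.A C.X X).hom ≫ M.A ◁ (T.hom ≫ X ◁ homMap g) ≫ (α_ M.A X D'.X).inv) := by
        simp
      exact h))
    (fun {M N} f => by
      ext
      exact (Category.comp_id _).trans (Category.id_comp _).symm)

end

end Bicategory

/-! ### Left Quillen functors and left-induced model structures. -/

section LeftInduced

open Limits

variable {𝓐 𝓑 𝓑' : Type*} [Category* 𝓐] [Category* 𝓑] [Category* 𝓑'] [ModelCategory 𝓐]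
  [ModelCategory 𝓑] [ModelCategory 𝓑']

theorem IsLeftInduced.isLeftQuillen {U : 𝓑' ⥤ 𝓑} (hU : IsLeftInduced U) (h : U.IsLeftAdjoint) :
    IsLeftQuillen U where
  isLeftAdjoint := h
  cofibration _ _ i := (hU.cofibration_iff i).1
  trivialCofibration _ _ i _ := (hU.weakEquivalence_iff i).1

theorem IsLeftInduced.isLeftQuillen_of_comp {U : 𝓑' ⥤ 𝓑} (hU : IsLeftInduced U) {F : 𝓐 ⥤ 𝓑'}
    (hF : F.IsLeftAdjoint) (h : IsLeftQuillen (F ⋙ U)) : IsLeftQuillen F where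
  isLeftAdjoint := hF
  cofibration _ _ i hi := (hU.cofibration_iff _).2 (h.cofibration i hi)
  trivialCofibration _ _ i hi hi' := (hU.weakEquivalence_iff _).2 (h.trivialCofibration i hi hi')

end LeftInduced

/-! ### Limits of right modules, and tensoring with the regular module. -/

section Modules

open Limits MonoidalCategory

variable {V : Type u} [Category.{v} V] [MonoidalCategory V]

/-- If `p` and `l ≫ p` are linear, then `l` is linear after composing with `p`. Applied to all
projections of a limit, this makes the induced map linear. -/
theorem comp_act_of_comp_eq {A X Y Z : V} {x : X ⊗ A ⟶ X} {y : Y ⊗ A ⟶ Y} {z : Z ⊗ A ⟶ Z}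
    {l : X ⟶ Y} {p : Y ⟶ Z} {q : X ⟶ Z} (hp : y ≫ p = p ▷ A ≫ z) (hq : x ≫ q = q ▷ A ≫ z)
    (h : l ≫ p = q) : (x ≫ l) ≫ p = (l ▷ A ≫ y) ≫ p := by
  rw [Category.assoc, Category.assoc, h, hp, hq, ← h, comp_whiskerRight_assoc]

variable [HasCoequalizers V] [∀ X : V, PreservesColimitsOfSize.{0, 0} (tensorLeft X)]
  [∀ X : V, PreservesColimitsOfSize.{0, 0} (tensorRight X)]

/-- The forgetful functor from right `A`-modules to `V` reflects limits. -/
instance reflectsLimit_forgetMod (A : Mon V) {J : Type*} [Category* J] (Φ : J ⥤ RightMod A) :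
    ReflectsLimit Φ (forgetMod A) where
  reflects {c} hc := ⟨
    { lift s := Bimod.Hom.mk (A := Mon.trivial V) (B := A) (hc.lift ((forgetMod A).mapCone s))
        (by
          -- The left action of the unit algebra is the unitor, so compatibility with it is
          -- naturality.
          erw [unit_actLeft, unit_actLeft]
          exact (leftUnitor_naturality _).symm)
        (by
          refine hc.hom_ext fun j => ?_
          have h1 := (c.π.app j).right_act_hom
          have h2 := (s.π.app j).right_act_hom
          have h3 := hc.fac ((forgetMod A).mapCone s) j
          exact comp_act_of_comp_eq h1 h2 h3)
      fac s j := Bimod.hom_ext _ _ (hc.fac ((forgetMod A).mapCone s) j)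
      uniq s m hm := Bimod.hom_ext _ _ (hc.uniq ((forgetMod A).mapCone s) m.hom
        (fun j => congrArg Bimod.Hom.hom (hm j))) }⟩

/-- Flatness concerns the functor to `V`; it lifts to right modules because the forgetful functor
reflects limits. -/
theorem preservesLimit_tensorComonad {A : Mon V} {C : Coring A} (hC : IsFlatCoring C)
    {M N : RightMod A} (f g : M ⟶ N) [IsCoreflexivePair f g] :
    PreservesLimit (parallelPair f g)
      (tensorComonad (toAlg (Mon.trivial V)) C).toFunctor :=
  have : PreservesLimit (parallelPair f g)
      (Bicategory.postcomp (toAlg (Mon.trivial V)) (C.X : toAlg A ⟶ toAlg A) ⋙ forgetMod A) :=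
    hC f g
  preservesLimit_of_reflects_of_preserves
    (Bicategory.postcomp (toAlg (Mon.trivial V)) (C.X : toAlg A ⟶ toAlg A)) (forgetMod A)

/-- The regular right module is not an identity 1-cell, its left action being forgotten. In `V` that
action plays no role, and the left unitor still identifies `A ⊗_A M` with `M`. -/
theorem regularRight_whiskerLeft {A B : Mon V} {M N : toAlg A ⟶ toAlg B} (g : M ⟶ N) :
    ∃ (i : (forgetMod B).obj (regularRight A ≫ M) ≅ (forgetMod B).obj ((underlyingRight A B).obj M))
      (j : (forgetMod B).obj ((underlyingRight A B).obj N) ≅ (forgetMod B).obj (regularRight A ≫ N)),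
      (forgetMod B).map (Bicategory.whiskerLeft (regularRight A) g) =
        i.hom ≫ (forgetMod B).map ((underlyingRight A B).map g) ≫ j.hom :=
  ⟨(Bimod.forget (B := B) A).mapIso (Bimod.leftUnitorBimod (X := A) (Y := B) M),
    (Bimod.forget (B := B) A).mapIso (Bimod.leftUnitorBimod (X := A) (Y := B) N).symm,
    congrArg Bimod.Hom.hom (Bimod.id_whiskerLeft_bimod g)⟩

end Modules

/-! ### The two assertions for morphisms of corings. -/

section MainTheorem

open Limits MonoidalCategory

variable {V : Type u} [Category.{v} V] [MonoidalCategory V] [SymmetricCategory V]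
    [MonoidalClosed V] [ModelCategory V]
    [∀ A : Mon V, ModelCategory (RightMod A)]
    [∀ (A : Mon V) (C : Coring A), ModelCategory (Comod C)]

variable (hInd : ∀ (A : Mon V) (C : Coring A), IsLeftInduced (forgetComod C))
  {A B : Mon V} {C : Coring A} {φ : A ⟶ B}

theorem isLeftQuillen_forgetComod {A : Mon V} (C : Coring A) (h : IsLeftInduced (forgetComod C)) :
    IsLeftQuillen (forgetComod C) :=
  h.isLeftQuillen (tensorComonad (toAlg (Mon.trivial V)) C).adj.isLeftAdjoint

include hInd

/-- After forgetting coactions, `can` is extension of scalars applied to the underlying module, and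
the model structure on the target is left-induced. -/
theorem isLeftQuillen_can (hφ : IsLeftQuillen (extendScalars φ)) :
    IsLeftQuillen (can φ C) :=
  (hInd B (pushCoring φ C)).isLeftQuillen_of_comp inferInstance
    ((isLeftQuillen_forgetComod C (hInd A C)).comp hφ :)

theorem isLeftQuillen_corestrict {C' : Coring A} (g : C ⟶ C') :
    IsLeftQuillen (corestrict g) :=
  (hInd A C').isLeftQuillen_of_comp inferInstance
    (isLeftQuillen_forgetComod C (hInd A C) :)

theorem weakEquivalence_corestrict_map_iff {C' : Coring A} (g : C ⟶ C') {M N : Comod C}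
    (k : M ⟶ N) : WeakEquivalence ((corestrict g).map k) ↔ WeakEquivalence k :=
  ((hInd A C').weakEquivalence_iff ((corestrict g).map k)).trans
    ((hInd A C).weakEquivalence_iff k).symm

theorem isQuillenEquivalence_corestrict {C' : Coring A} {g : C ⟶ C'}
    (hg : IsCopureWeakEquivalence g) : IsQuillenEquivalence (corestrictAdjunction g) :=
  .of_counit (isLeftQuillen_corestrict hInd g)
    (fun _ _ k => weakEquivalence_corestrict_map_iff hInd g k) hg.weakEquivalence_counit

/-- Under the flatness assumptions, the counit of the canonical adjunction is a weak equivalence at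
every comodule. -/
theorem weakEquivalence_counit_can
    (hB : ∀ ⦃M N : RightMod B⦄ (g : M ⟶ N),
      WeakEquivalence g ↔ WeakEquivalence ((forgetMod B).map g))
    (hC : IsFlatCoring C) (hφ : IsStronglyHomotopyFlat (ext φ))
    {G : Comod (pushCoring φ C) ⥤ Comod C} (adj : can φ C ⊣ G) (N : Comod (pushCoring φ C)) :
    WeakEquivalence (adj.counit.app N) := by
  rw [(hInd B _).weakEquivalence_iff, hB]
  -- Both composites to `V` send a comodule to `M ⊗_A B` on the nose, so the comparison isomorphism
  -- is the identity.
  exact weakEquivalence_counit_of_cofree adj (forgetMod B) (forgetComod C) (tensorFunctor (ext φ))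
    (Iso.refl _)
    (preservesLimit_comonad_forget (fun _ _ f g _ => preservesLimit_tensorComonad hC f g))
    (hφ.weakEquivalence_limit_post _)
    (isIso_counit_univBraiding_cofree (extResAdjunction φ) C adj) N

/-- A morphism of corings whose change-of-corings counit is a weak equivalence at fibrant
comodules is a copure weak equivalence, provided that the base algebra is fibrant. -/
theorem isCopureWeakEquivalence_of_counit
    (hA : ∀ ⦃M N : RightMod A⦄ (g : M ⟶ N),
      WeakEquivalence g ↔ WeakEquivalence ((forgetMod A).map g))
    (hfib : IsFibrant (regularRight A)) {C' : Coring A} (g : C ⟶ C')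
    (h : ∀ M : Comod C', IsFibrant M →
      WeakEquivalence ((corestrictAdjunction g).counit.app M)) :
    IsCopureWeakEquivalence g where
  weakEquivalence_counit := h
  weakEquivalence := by
    obtain ⟨e, he⟩ := exists_counit_changeOfCorings_cofree g (corestrictAdjunction g)
      (regularRight A)
    -- The cofree functor is right adjoint to a left Quillen functor, so the cofree comodule on a
    -- fibrant module is fibrant.
    have := h _ ((isLeftQuillen_forgetComod C' (hInd A C')).isFibrant_obj
      (tensorComonad (toAlg (Mon.trivial V)) C').adj (regularRight A))
    have h1 : WeakEquivalence ((corestrict g).map e.hom ≫ (corestrictAdjunction g).counit.app _) :=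
      inferInstance
    rw [(hInd A C').weakEquivalence_iff] at h1
    have h2 : WeakEquivalence (Bicategory.whiskerLeft (regularRight A) (homMap g)) := he ▸ h1
    rw [hA] at h2
    -- The counit has been identified with `A ⊗_A g`; the unit isomorphisms turn this into `g`.
    obtain ⟨i, j, hij⟩ := regularRight_whiskerLeft (homMap g)
    rw [hij, weakEquivalence_precomp_iff, weakEquivalence_postcomp_iff] at h2
    exact (hA _).2 h2

variable {D : Coring B} {f : pushCoring φ C ⟶ D}

theorem isQuillenEquivalence_homAdjunction (hφ : SatisfiesEffectiveHomotopicDescent φ C)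
    (hf : IsCopureWeakEquivalence f) : IsQuillenEquivalence (homAdjunction φ f) :=
  (IsQuillenEquivalence.comp hφ (isQuillenEquivalence_corestrict hInd hf)).of_iso
    ((canonicalBraiding φ C).functorCompHomIso f) _

theorem satisfiesEffectiveHomotopicDescent_and_isCopureWeakEquivalence
    (hφ : IsLeftQuillen (extendScalars φ))
    (hB : ∀ ⦃M N : RightMod B⦄ (g : M ⟶ N),
      WeakEquivalence g ↔ WeakEquivalence ((forgetMod B).map g))
    (hC : IsFlatCoring C) (hφ' : IsStronglyHomotopyFlat (ext φ))
    (hfib : IsFibrant (regularRight B)) (h : IsQuillenEquivalence (homAdjunction φ f)) :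
    SatisfiesEffectiveHomotopicDescent φ C ∧ IsCopureWeakEquivalence f := by
  let adj := Adjunction.ofIsLeftAdjoint (can φ C)
  have hcan : ∀ N, WeakEquivalence (adj.counit.app N) :=
    weakEquivalence_counit_can hInd hB hC hφ' adj
  have hmap : ∀ ⦃M N : Comod C⦄ (k : M ⟶ N), WeakEquivalence k →
      WeakEquivalence ((can φ C).map k) := fun M N k hk => by
    rw [(hInd B _).weakEquivalence_iff, hB]
    exact hφ'.isHomotopyFlat _ (((hInd A C).weakEquivalence_iff k).1 hk)
  have h' : IsQuillenEquivalence (adj.comp (corestrictAdjunction f)) :=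
    h.of_iso ((canonicalBraiding φ C).functorCompHomIso f).symm _
  have hmap' : ∀ ⦃M N : Comod C⦄ (k : M ⟶ N), WeakEquivalence k →
      WeakEquivalence ((can φ C ⋙ corestrict f).map k) := fun M N k hk =>
    (weakEquivalence_corestrict_map_iff hInd f _).2 (hmap k hk)
  refine ⟨.of_counit (isLeftQuillen_can hInd hφ) (fun M N k => ⟨fun hk => ?_, fun hk => hmap k hk⟩)
    (fun N _ => hcan N), isCopureWeakEquivalence_of_counit hInd hB hfib f fun M hM => ?_⟩
  -- If `can` sends `k` to a weak equivalence, so does the composite, which reflects weak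
  -- equivalences.
  · exact h'.weakEquivalence_of_map hmap' k ((weakEquivalence_corestrict_map_iff hInd f _).2 hk)
  -- The composite counit is `corestrict f` of the canonical counit followed by the counit for `f`.
  -- The first two of these are weak equivalences, hence so is the third.
  · have h1 := h'.weakEquivalence_counit hmap' M hM
    rw [Adjunction.comp_counit_app] at h1
    have := (weakEquivalence_corestrict_map_iff hInd f _).2
      (hcan ((corestrict f).rightAdjoint.obj M))
    exact weakEquivalence_of_precomp ((corestrict f).map (adj.counit.app _)) _

end MainTheorem

end CoringMorita

theorem mainTheorem6 {V : Type u} [Category.{v} V] [MonoidalCategory V] [SymmetricCategory V]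
    [MonoidalClosed V] [ModelCategory V] [IsMonoidalModelCategory V]
    [∀ A : Mon V, ModelCategory (RightMod A)]
    [∀ (A : Mon V) (C : Coring A), ModelCategory (Comod C)]
    (hInd : ∀ (A : Mon V) (C : Coring A), IsLeftInduced (forgetComod C))
    {A B : Mon V} (C : Coring A) (D : Coring B) (φ : A ⟶ B) (f : pushCoring φ C ⟶ D)
    (hφ : IsLeftQuillen (extendScalars φ)) :
    (SatisfiesEffectiveHomotopicDescent φ C → IsCopureWeakEquivalence f →
      IsQuillenEquivalence (homAdjunction φ f)) ∧
    ((∀ ⦃M N : RightMod B⦄ (g : M ⟶ N),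
        WeakEquivalence g ↔ WeakEquivalence ((forgetMod B).map g)) →
      IsFlatCoring C → IsStronglyHomotopyFlat (ext φ) → IsFibrant (regularRight B) →
      IsQuillenEquivalence (homAdjunction φ f) →
      SatisfiesEffectiveHomotopicDescent φ C ∧ IsCopureWeakEquivalence f) :=
  ⟨isQuillenEquivalence_homAdjunction hInd,
    satisfiesEffectiveHomotopicDescent_and_isCopureWeakEquivalence hInd hφ⟩
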